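/- **Setting.** Let $T>0$. A network $\Gamma\subset\mathbb R^d$ consists of finitely many distinct vertices $x_i$, $i\in I$, and finitely many smooth non-self-intersecting oriented arcs $e_j$, $j\in J$, parametrized by arc length through injective maps $\pi_j$ on $D_j=[0,L_j]$ (bounded arc from the vertex $\pi_j(0)$ to the vertex $\pi_j(L_j)$), on $D_j=[0,\infty)$ (arc issuing from the vertex $\pi_j(0)$), or on $D_j=(-\infty,0]$ (arc ending in the vertex $\pi_j(0)$; here put $L_j=0$). Arcs meet each other and the vertices only at their endpoints; $\Gamma=\bigcup_j\pi_j(D_j)$ is (path-)connected. $\mathrm{Out}(x_i)$ and $\mathrm{Inc}(x_i)$ are the sets of arcs starting, respectively ending, at $x_i$. Every vertex has an outgoing arc (no sinks); the vertices without incoming arcs are the sources, forming the set $\mathcal S$, and each source has exactly one outgoing arc. $d_\Gamma$ is the path distance on $\Gamma$; $\Gamma\times[0,T]$ carries the distance $d_\Gamma(x,y)+|t-s|$. For finite measures on such a space, $\|\mu\|^*_{BL}=\sup\{|\langle\mu,f\rangle|:\|f\|_\infty+|f|_L\le 1\}$, where $|f|_L$ is the Lipschitz constant. $\mathcal M^+$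 denotes finite positive Borel measures. **Data.** $m_0=\sum_j m_0^j\in\mathcal M^+(\Gamma)$ with $m_0^j$ carried by $e_j$; $\sigma_0=\sum_{x_i\in\mathcal S}\sigma_0^i$ with $\sigma_0^i\in\mathcal M^+(\{x_i\}\times[0,T])$; functions $p_{kj}\in BV([0,T])$ with values in $[0,1]$ such that, for every arc $e_k$ that ends in a vertex, $\sum_jp_{kj}(t)=1$ and $p_{kj}(t)=0$ unless $e_j$ starts where $e_k$ ends; a velocity field $v[\mu](x)$, $\mu\in\mathcal M^+(\Gamma)$, given on each arc (no continuity across vertices is required), with $0\le v\le V_{max}$, $V_{max}>0$, and, for some $L\geq 0$, $|v[\mu](x)-v[\mu](y)|\le L|x-y|$ on each arc (in its parameter) and $|v[\mu](x)-v[\nu](x)|\le L\|\mu-\nu\|^*_{BL}$. **Approximate solutions.** For an interval $[a,b]$ let $C_0^\infty(\Gamma\times[a,b])$ be the continuous functions on $\Gamma\times[a,b]$ that are smooth on each $e_j\times[a,b]$, with bounded first derivatives, and vanish at infinity along unbounded arcs. For $N\in\mathbb N$ put $t_n=nT/2^N$ and $I_n=[t_n,t_{n+1})$, $0\le n<2^N$.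 An approximate solution $m^N$ is a curve $t\mapsto m^N_t=\sum_j m^{N,j}_t\in\mathcal M^+(\Gamma)$, $t\in[0,T]$, with $m^{N,j}_t$ carried by $e_j$ and $m^{N,j}_0=m_0^j$ for every $j$, which on each $[t_n,t_{n+1}]$ is measurable in $t$ with $\int m^N_t(\Gamma)\,dt<\infty$ and solves there the linear transport problem with velocity frozen at time $t_n$, i.e. $$\langle m^N_{t_{n+1}},f(\cdot,t_{n+1})\rangle-\langle m^N_{t_n},f(\cdot,t_n)\rangle=\langle\sigma_0\llcorner I_n,f\rangle+\int_{t_n}^{t_{n+1}}\big\langle m^N_t,(\partial_t+v[m^N_{t_n}]\partial_x)f(\cdot,t)\big\rangle\,dt$$ for all $f\in C_0^\infty(\Gamma\times[t_n,t_{n+1}])$. Moreover there are traces: finite positive measures $\nu^-_j$ and $\nu^+_j$ on $I_n$ (zero where $e_j$ has no initial, respectively terminal, vertex) such that for all smooth $g$ on $e_j\times[t_n,t_{n+1}]$ with bounded first derivatives vanishing at infinity $$\langle m^{N,j}_{t_{n+1}},g(\cdot,t_{n+1})\rangle-\langle m^{N,j}_{t_n},g(\cdot,t_n)\rangle-\int_{t_n}^{t_{n+1}}\langle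 m^{N,j}_t,(\partial_t+v[m^N_{t_n}]\partial_x)g\rangle\,dt=\int g(\pi_j(0),t)\,d\nu_j^-(t)-\int g(\pi_j(L_j),t)\,d\nu_j^+(t),$$ with $\nu^-_j=\sigma_0^i\llcorner I_n$ if $e_j$ starts at the source $x_i$, and $\nu_j^-=\sum_{k\in\mathrm{Inc}(x_i)}p_{kj}\,\nu_k^+$ if $e_j$ starts at a vertex $x_i\notin\mathcal S$. Since these relations determine $m^N_t$ inside $I_n$ only for almost every $t$, the left-continuous representative is taken: $r\mapsto\langle m^N_r,\varphi\rangle$ is left-continuous at every $t\in(t_n,t_{n+1})$ for each time-independent test function $\varphi$. **Proposition.** There is a constant $C=C(T)>0$, depending only on $T$, such that for every network, all data, every $N\in\mathbb N$ and every approximate solution $m^N$ $$\|m^N_t\|^*_{BL}\le C\,\big(\|m_0\|^*_{BL}+\|\sigma_0\|^*_{BL}\big)\qquad\text{for all }t\in[0,T].$$ Moreover, for every network and all data there is a constant $C>0$, independent of $N$, $s$, $t$ and of $m^N$, such that $$\|m^N_t-m^N_s\|^*_{BL}\le\sigma_0([s,t))+C\,|t-s|\qquad\text{for all }0\le s<t\le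 T,$$ where $\sigma_0([s,t))=\sum_{x_i\in\mathcal S}\sigma^i_0([s,t))$. -/

import Mathlib

open scoped ENNReal NNReal ContDiff
open MeasureTheory

/-! ## Bounded Lipschitz functions and the dual norm on measures -/

/-- The norm `‖f‖_∞ + |f|_L` of a function `f` on the set `S` with distance `ρ`
(values of `f` outside `S` play no role). -/
noncomputable def blNorm {X : Type*} (S : Set X) (ρ : X → X → ℝ≥0∞) (f : X → ℝ) : ℝ≥0∞ :=
  (⨆ x ∈ S, ‖f x‖ₑ) + ⨆ x ∈ S, ⨆ y ∈ S, ⨆ _ : x ≠ y, ‖f x - f y‖ₑ / ρ x y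

/-- The dual bounded Lipschitz norm `‖μ - ν‖*_BL` of the difference of two finite measures on `S`:
the supremum of `|⟨μ - ν, f⟩|` over all `f` with `‖f‖_BL ≤ 1`. -/
noncomputable def blDist {X : Type*} [MeasurableSpace X] (S : Set X) (ρ : X → X → ℝ≥0∞)
    (μ ν : Measure X) : ℝ≥0∞ :=
  ⨆ f : X → ℝ, ⨆ _ : blNorm S ρ f ≤ 1, ‖(∫ x in S, f x ∂μ) - ∫ x in S, f x ∂ν‖ₑ

/-! ## Networks -/

/-- Combinatorial type of an oriented arc: a bounded arc from `x` to `y` of length `L`, parametrized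
by `[0, L]`; an unbounded arc originating from `x`, parametrized by `[0, ∞)`; an unbounded arc
terminating in `y`, parametrized by `(-∞, 0]`. -/
inductive ArcType (V : Type) where
  | bounded (x y : V) (L : ℝ)
  | outRay (x : V)
  | inRay (y : V)

namespace ArcType

variable {V : Type}

/-- The vertex from which the arc goes out, if any. -/
def source : ArcType V → Option V
  | bounded x _ _ => some x
  | outRay x => some x
  | inRay _ => none

/-- The vertex into which the arc comes in, if any. -/
def target : ArcType V → Option V
  | bounded _ y _ => some y
  | outRay _ => none
  | inRay y => some y

/-- The parameter domain. -/
def dom : ArcType V → Set ℝ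
  | bounded _ _ L => Set.Icc 0 L
  | outRay _ => Set.Ici 0
  | inRay _ => Set.Iic 0

/-- The parameter of the terminal vertex (unused for an arc without terminal vertex).
The parameter of the initial vertex is always `0`. -/
def endParam : ArcType V → ℝ
  | bounded _ _ L => L
  | outRay _ => 0
  | inRay _ => 0

end ArcType

/-- A connected oriented network in `ℝ^d` with finitely many vertices and finitely many smooth
non-self-intersecting arcs, parametrized by arc length, meeting only at vertices.  There are no
sinks, and every source has exactly one outgoing arc. -/
structure Network (V E : Type) [Fintype V] [Fintype E] (d : ℕ) where
  /-- position of the vertices -/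
  pos : V → EuclideanSpace ℝ (Fin d)
  pos_injective : Function.Injective pos
  /-- type of the arcs -/
  arc : E → ArcType V
  length_pos : ∀ j x y L, arc j = ArcType.bounded x y L → 0 < L
  /-- parametrization of the arcs; only its values on the parameter domain matter -/
  param : E → ℝ → EuclideanSpace ℝ (Fin d)
  param_smooth : ∀ j, ContDiff ℝ ∞ (param j)
  param_injOn : ∀ j, Set.InjOn (param j) (arc j).dom
  param_unit_speed : ∀ j, ∀ s ∈ (arc j).dom, ‖deriv (param j) s‖ = 1
  param_source : ∀ j x, (arc j).source = some x → param j 0 = pos x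
  param_target : ∀ j x, (arc j).target = some x → param j (arc j).endParam = pos x
  /-- an arc meets vertices only at its endpoints -/
  vertex_endpoint : ∀ j, ∀ s ∈ (arc j).dom, ∀ x, param j s = pos x →
    ((arc j).source = some x ∧ s = 0) ∨ ((arc j).target = some x ∧ s = (arc j).endParam)
  /-- two different arcs meet only at vertices -/
  arcs_meet : ∀ j k, j ≠ k → ∀ s ∈ (arc j).dom, ∀ s' ∈ (arc k).dom,
    param j s = param k s' → ∃ x, param j s = pos x
  connected : IsPathConnected (⋃ j, param j '' (arc j).dom)
  no_sink : ∀ x, ∃ j, (arc j).source = some x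
  source_unique_out : ∀ x, (∀ k, (arc k).target ≠ some x) → ∃! j, (arc j).source = some x

namespace Network

variable {V E : Type} [Fintype V] [Fintype E] {d : ℕ} (Γ : Network V E d)

/-- The network as a set of points. -/
def carrier : Set (EuclideanSpace ℝ (Fin d)) := ⋃ j, Γ.param j '' (Γ.arc j).dom

/-- A vertex is a source if it has no incoming arc. -/
def IsSource (x : V) : Prop := ∀ k, (Γ.arc k).target ≠ some x

/-- The path distance: infimum of the lengths of the continuous curves in the network
from `x` to `y`. -/
noncomputable def pathDist (x y : EuclideanSpace ℝ (Fin d)) : ℝ≥0∞ :=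
  ⨅ (c : ℝ → EuclideanSpace ℝ (Fin d)) (_ : ContinuousOn c (Set.Icc 0 1))
    (_ : Set.MapsTo c (Set.Icc 0 1) Γ.carrier) (_ : c 0 = x) (_ : c 1 = y),
    eVariationOn c (Set.Icc 0 1)

/-- The distance `d_Γ(x, y) + |t - s|` on `Γ × [0, T]`. -/
noncomputable def spaceTimeDist (a b : EuclideanSpace ℝ (Fin d) × ℝ) : ℝ≥0∞ :=
  Γ.pathDist a.1 b.1 + edist a.2 b.2

/-- `‖μ - ν‖*_BL` on the network. -/
noncomputable def bl (μ ν : Measure (EuclideanSpace ℝ (Fin d))) : ℝ≥0∞ :=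
  blDist Γ.carrier Γ.pathDist μ ν

/-- `‖μ - ν‖*_BL` on `Γ × [0, T]`. -/
noncomputable def blSpaceTime (T : ℝ) (μ ν : Measure (EuclideanSpace ℝ (Fin d) × ℝ)) : ℝ≥0∞ :=
  blDist (Γ.carrier ×ˢ Set.Icc 0 T) Γ.spaceTimeDist μ ν

/-- `μ` is a finite positive measure on the network. -/
def IsMeasureOn (μ : Measure (EuclideanSpace ℝ (Fin d))) : Prop :=
  IsFiniteMeasure μ ∧ μ Γ.carrierᶜ = 0

/-- The measure `∑ⱼ mʲ` on the network with parts `mʲ` on the arcs, each `mʲ` being given in the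
parameter of its arc. -/
noncomputable def toMeasure (m : E → Measure ℝ) : Measure (EuclideanSpace ℝ (Fin d)) :=
  ∑ j, (m j).map (Γ.param j)

/-- The family `(mʲ)` consists of finite measures carried by the parameter domains of the arcs. -/
def IsArcFamily (m : E → Measure ℝ) : Prop :=
  ∀ j, IsFiniteMeasure (m j) ∧ m j (Γ.arc j).domᶜ = 0

/-- The measure `∑ᵢ σⁱ` on `Γ × [0, T]`, where `σⁱ` lives on `{xᵢ} × [0, T]`. -/
noncomputable def sourceMeasure (σ : V → Measure ℝ) :
    Measure (EuclideanSpace ℝ (Fin d) × ℝ) :=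
  ∑ x, (σ x).map (fun t => (Γ.pos x, t))

/-- A smooth function on `e_j × [a, b]` (restriction of a smooth function of two variables)
vanishing at infinity if the arc is unbounded, with bounded first derivatives.
The first variable is space, the second one time. -/
structure IsArcTest (j : E) (a b : ℝ) (g : ℝ → ℝ → ℝ) : Prop where
  smooth : ContDiff ℝ ∞ (fun z : ℝ × ℝ => g z.1 z.2)
  vanish : ∀ ε > 0, ∃ R : ℝ, ∀ s ∈ (Γ.arc j).dom, R ≤ |s| → ∀ t ∈ Set.Icc a b, |g s t| ≤ ε
  bounded_deriv : ∃ K : ℝ, ∀ s ∈ (Γ.arc j).dom, ∀ t ∈ Set.Icc a b,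
    |deriv (fun r => g r t) s| ≤ K ∧ |deriv (fun r => g s r) t| ≤ K

/-- A test function in `C^∞_0(Γ × [a, b])`: the family `f` of its restrictions to the arcs and its
values `w` at the vertices; continuity on the network means that they match. -/
structure IsTest (a b : ℝ) (f : E → ℝ → ℝ → ℝ) (w : V → ℝ → ℝ) : Prop where
  arc_test : ∀ j, Γ.IsArcTest j a b (f j)
  source_match : ∀ j x, (Γ.arc j).source = some x → ∀ t ∈ Set.Icc a b, f j 0 t = w x t
  target_match : ∀ j x, (Γ.arc j).target = some x → ∀ t ∈ Set.Icc a b,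
    f j (Γ.arc j).endParam t = w x t

/-! ## The linear problem on a time interval -/

/-- `∫ₐᵇ ⟨mʲ_t, (∂_t + u ∂_x) g⟩ dt`. -/
noncomputable def transportTerm (a b : ℝ) (u : ℝ → ℝ) (μ : ℝ → Measure ℝ) (g : ℝ → ℝ → ℝ) : ℝ :=
  ∫ t in a..b, ∫ s, (deriv (fun r => g s r) t + u s * deriv (fun r => g r t) s) ∂(μ t)

/-- `ν⁻` and `ν⁺` are the traces at the initial and at the terminal vertex of the solution
`(mʲ_t)_t` of the transport equation with velocity `u` on the arc `e_j` during `[a, b)`: they are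
finite measures on `[a, b)` given by the integration by parts formula on the arc, and there is no
trace where there is no vertex. -/
structure IsTracePair (j : E) (a b : ℝ) (u : ℝ → ℝ) (μ : ℝ → Measure ℝ) (νin νout : Measure ℝ) :
    Prop where
  finite_in : IsFiniteMeasure νin
  finite_out : IsFiniteMeasure νout
  in_support : νin (Set.Ico a b)ᶜ = 0
  out_support : νout (Set.Ico a b)ᶜ = 0
  in_none : (Γ.arc j).source = none → νin = 0
  out_none : (Γ.arc j).target = none → νout = 0
  by_parts : ∀ g, Γ.IsArcTest j a b g →
    ((∫ s, g s b ∂(μ b)) - ∫ s, g s a ∂(μ a)) - transportTerm a b u μ g =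
      (∫ t, g 0 t ∂νin) - ∫ t, g (Γ.arc j).endParam t ∂νout

open Classical in
/-- `t ↦ m_t = ∑ⱼ mʲ_t`, `t ∈ [a, b]`, is the measure-valued solution on `Γ × [a, b)` of the linear
problem with velocity `u`, initial datum `m_a`, source `σ` restricted to `[a, b)` and distribution
matrix `p`.  The measure `m(dx dt) = m_t(dx) ⊗ dt` determines `m_t` only for almost every `t`;
since the source acts on `[a, b)`, the representative that is continuous from the left is used. -/
structure IsLinearSolution (a b : ℝ) (u : E → ℝ → ℝ) (σ : V → Measure ℝ) (p : E → E → ℝ → ℝ)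
    (m : ℝ → E → Measure ℝ) : Prop where
  arcFamily : ∀ t ∈ Set.Icc a b, Γ.IsArcFamily (m t)
  measurable : ∀ j, Measurable (fun t : Set.Icc a b => m t j)
  finite : ∀ j, ∫⁻ t in Set.Icc a b, m t j Set.univ < ⊤
  left_continuous : ∀ f w, Γ.IsTest a b f w → ∀ t ∈ Set.Ioo a b,
    ContinuousWithinAt (fun r => ∑ j, ∫ s, f j s t ∂(m r j)) (Set.Icc a t) t
  /-- the weak form of the transport equation with initial datum and source -/
  balance : ∀ f w, Γ.IsTest a b f w →
    (∑ j, ∫ s, f j s b ∂(m b j)) - ∑ j, ∫ s, f j s a ∂(m a j) =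
      (∑ x, ∫ t in Set.Ico a b, w x t ∂(σ x)) +
        ∑ j, transportTerm a b (u j) (fun t => m t j) (f j)
  /-- the traces on the arcs satisfy the boundary and the transmission conditions -/
  vertex : ∃ νin νout : E → Measure ℝ,
    (∀ j, Γ.IsTracePair j a b (u j) (fun t => m t j) (νin j) (νout j)) ∧
    (∀ j x, (Γ.arc j).source = some x → Γ.IsSource x → νin j = (σ x).restrict (Set.Ico a b)) ∧
    (∀ j x, (Γ.arc j).source = some x → ¬ Γ.IsSource x → ∀ φ : ℝ → ℝ, ContDiff ℝ ∞ φ →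
      ∫ t, φ t ∂(νin j) =
        ∑ k with (Γ.arc k).target = some x, ∫ t, p k j t * φ t ∂(νout k))

/-! ## The nonlinear problem and its semi-discrete approximation -/

/-- Data of the nonlinear transport problem on `Γ × [0, T]`. -/
structure Data (T : ℝ) where
  /-- initial mass distribution, arc by arc -/
  m0 : E → Measure ℝ
  m0_arcFamily : Γ.IsArcFamily m0
  /-- boundary measures at the sources, as measures on the time interval -/
  σ : V → Measure ℝ
  σ_finite : ∀ x, IsFiniteMeasure (σ x)
  σ_support : ∀ x, σ x (Set.Icc 0 T)ᶜ = 0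
  σ_source : ∀ x, ¬ Γ.IsSource x → σ x = 0
  /-- distribution matrix: `p k j` is the fraction of mass flowing from `e_k` to `e_j` -/
  p : E → E → ℝ → ℝ
  p_nonneg : ∀ k j, ∀ t ∈ Set.Icc 0 T, 0 ≤ p k j t
  p_le_one : ∀ k j, ∀ t ∈ Set.Icc 0 T, p k j t ≤ 1
  p_sum : ∀ k, (Γ.arc k).target ≠ none → ∀ t ∈ Set.Icc 0 T, ∑ j, p k j t = 1
  p_zero : ∀ k j, (Γ.arc k).target ≠ none → (Γ.arc k).target ≠ (Γ.arc j).source →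
    ∀ t ∈ Set.Icc 0 T, p k j t = 0
  p_bv : ∀ k j, BoundedVariationOn (p k j) (Set.Icc 0 T)
  /-- velocity field: `v μ j s` is the value of `v[μ]` at the point of parameter `s` of `e_j`;
  no continuity across the vertices is required -/
  v : Measure (EuclideanSpace ℝ (Fin d)) → E → ℝ → ℝ
  Vmax : ℝ
  Vmax_pos : 0 < Vmax
  v_nonneg : ∀ μ, Γ.IsMeasureOn μ → ∀ j, ∀ s ∈ (Γ.arc j).dom, 0 ≤ v μ j s
  v_le : ∀ μ, Γ.IsMeasureOn μ → ∀ j, ∀ s ∈ (Γ.arc j).dom, v μ j s ≤ Vmax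
  /-- Lipschitz constant of the velocity field -/
  L : ℝ≥0
  v_lipschitz_state : ∀ μ, Γ.IsMeasureOn μ → ∀ j, ∀ s ∈ (Γ.arc j).dom, ∀ s' ∈ (Γ.arc j).dom,
    |v μ j s - v μ j s'| ≤ L * |s - s'|
  v_lipschitz_measure : ∀ μ ν, Γ.IsMeasureOn μ → Γ.IsMeasureOn ν →
    ∀ j, ∀ s ∈ (Γ.arc j).dom, ‖v μ j s - v ν j s‖ₑ ≤ L * Γ.bl μ ν

/-- `m` is the approximate solution `m^N`: with `t_n = n T / 2^N`, it starts from `m0` and solves on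
each `[t_n, t_{n+1})` the linear problem with frozen velocity `v[m_{t_n}]`, with the value at `t_n`
reached on the preceding interval as initial datum. -/
structure IsApproxSolution {T : ℝ} (D : Γ.Data T) (N : ℕ) (m : ℝ → E → Measure ℝ) : Prop where
  initial : m 0 = D.m0
  step : ∀ n : ℕ, n < 2 ^ N →
    Γ.IsLinearSolution (n * (T / 2 ^ N)) ((n + 1) * (T / 2 ^ N))
      (D.v (Γ.toMeasure (m (n * (T / 2 ^ N))))) D.σ D.p m

end Network

/-! For a positive measure carried by the network the dual norm is just the total mass: `|f| ≤ 1`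
gives one inequality and the admissible function `f = 1` the other. The first estimate is therefore
conservation of mass. The weak equation is tested with spatial cut-offs that equal `1` on growing
balls and have slopes tending to zero; the transport term disappears in the limit, and the mass at
time `t` is the initial mass plus the inflow on `[0, t)` (`IsLinearSolution.mass_eq`). Hence `C = 1`
works.

For the second estimate, a test function with `‖f‖_BL ≤ 1` sees at most `σ₀([s, t))` from the
sources, and a transport term of at most speed times slope times mass times `t - s`. The mass is
already bounded independently of `N`, so the constant is too. Such an `f` is neither smooth nor
decaying. It is replaced on each arc by smooth compactly supported functions with universal bounds
that keep the exact endpoint values (`LipschitzOnWith.exists_contDiff_hasCompactSupport`): the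
pieces then still match at the vertices, and the sources keep the weight `f(x_i)`, so `σ₀([s, t))`
carries the factor `1`. Dominated convergence returns to `f`.

The weak equation is given only on whole time steps. Testing with a spatial function times smooth
time cut-offs, whose derivatives concentrate to the left of `t`, gives it on `[a, t)` by left
continuity (`static_balance`). Consecutive steps are joined by the triangle inequality and the
additivity of `σ₀` on half-open intervals. -/

open Filter Topology

/-! ## Smooth approximation of functions of one variable -/

/-- Mollification: a Lipschitz function on the line is uniformly close to a smooth function with
the same Lipschitz constant. -/
theorem LipschitzWith.exists_contDiff_dist_le {h : ℝ → ℝ} {K : ℝ≥0} (hh : LipschitzWith K h)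
    {δ : ℝ} (hδ : 0 < δ) :
    ∃ g : ℝ → ℝ, ContDiff ℝ ∞ g ∧ (∀ x, |g x - h x| ≤ K * δ) ∧ LipschitzWith K g := by
  let φ : ContDiffBump (0 : ℝ) := ⟨δ / 2, δ, half_pos hδ, half_lt_self hδ⟩
  let ρ := φ.normed volume
  have hρ : Continuous ρ := φ.continuous_normed
  have hρc : HasCompactSupport ρ := φ.hasCompactSupport_normed
  have hint (x : ℝ) : Integrable (fun t => ρ t * h (x - t)) :=
    (hρ.mul (hh.continuous.comp (continuous_const.sub continuous_id))).integrable_of_hasCompactSupport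
      hρc.mul_right
  let g := convolution ρ h (ContinuousLinearMap.lsmul ℝ ℝ) volume
  have hg (x : ℝ) : g x = ∫ t, ρ t * h (x - t) := rfl
  refine ⟨g, ?_, fun x => ?_, LipschitzWith.of_dist_le_mul fun x y => ?_⟩
  · exact hρc.contDiff_convolution_left _ φ.contDiff_normed hh.continuous.locallyIntegrable
  · have := φ.dist_normed_convolution_le (μ := volume) (g := h) (x₀ := x) (ε := K * δ)
      hh.continuous.aestronglyMeasurable (fun y hy => (hh.dist_le_mul y x).trans
        (mul_le_mul_of_nonneg_left (Metric.mem_ball.1 hy).le K.2))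
    simpa [Real.dist_eq] using this
  -- The kernel is nonnegative with integral one, so averaging the translates of `h` does not
  -- enlarge the Lipschitz constant.
  · rw [dist_eq_norm, hg, hg, ← integral_sub (hint x) (hint y)]
    have hbound : ∀ t, ‖ρ t * h (x - t) - ρ t * h (y - t)‖ ≤ ρ t * (K * dist x y) := fun t => by
      rw [← mul_sub, norm_mul, Real.norm_of_nonneg (φ.nonneg_normed t), ← dist_eq_norm]
      refine mul_le_mul_of_nonneg_left ?_ (φ.nonneg_normed t)
      simpa using hh.dist_le_mul (x - t) (y - t)
    calc _ ≤ ∫ t, ρ t * (K * dist x y) :=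
          norm_integral_le_of_norm_le
            ((hρ.integrable_of_hasCompactSupport hρc).mul_const _) (Eventually.of_forall hbound)
      _ = K * dist x y := by rw [integral_mul_const, φ.integral_normed, one_mul]

/-- Smooth cut-off functions with arbitrarily small slope. -/
theorem exists_smooth_cutoff (R : ℝ) {ε : ℝ} (hε : 0 < ε) :
    ∃ χ : ℝ → ℝ, ContDiff ℝ ∞ χ ∧ HasCompactSupport χ ∧ (∀ s, χ s ∈ Set.Icc (0 : ℝ) 1) ∧
      (∀ s, |s| ≤ R → χ s = 1) ∧ ∀ s, |deriv χ s| ≤ ε := by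
  let φ : ContDiffBump (0 : ℝ) := ⟨1, 2, one_pos, one_lt_two⟩
  have hφ : ContDiff ℝ ∞ φ := φ.contDiff
  obtain ⟨K, hK⟩ := φ.hasCompactSupport.deriv.exists_bound_of_continuous
    (hφ.continuous_deriv (by simp))
  have hK0 : 0 ≤ K := (norm_nonneg _).trans (hK 0)
  -- Rescaling by `r ≥ R` sends `|s| ≤ R` into the unit ball, where `φ = 1`; `r ≥ K / ε` brings the
  -- slope bound `K / r` below `ε`.
  let r : ℝ := max 1 (max R (K / ε))
  have hr : 0 < r := one_pos.trans_le (le_max_left _ _)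
  have hrR : R ≤ r := (le_max_left _ _).trans (le_max_right _ _)
  have hrK : K / ε ≤ r := (le_max_right _ _).trans (le_max_right _ _)
  refine ⟨fun s => φ (r⁻¹ * s), by fun_prop, ?_, fun s => ⟨φ.nonneg, φ.le_one⟩, fun s hs => ?_,
    fun s => ?_⟩
  · exact φ.hasCompactSupport.comp_smul (c := r⁻¹) (inv_ne_zero hr.ne')
  · refine φ.one_of_mem_closedBall ?_
    rw [Metric.mem_closedBall, dist_zero_right, norm_mul, norm_inv, Real.norm_of_nonneg hr.le,
      inv_mul_le_iff₀ hr, mul_one]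
    exact hs.trans hrR
  · rw [deriv_comp_mul_left, smul_eq_mul, abs_mul, abs_of_pos (inv_pos.2 hr), inv_mul_le_iff₀ hr]
    exact (hK _).trans ((div_le_iff₀ hε).1 hrK)

/-! ### Time cut-offs and one-sided localization in time. -/

/-- Smooth cut-offs `φₙ` in time, decreasing from `1` to `0` on `[t - 1 / (n + 1), t]`. -/
noncomputable def timeCutoff (t : ℝ) (n : ℕ) (r : ℝ) : ℝ :=
  Real.smoothTransition ((t - r) * (n + 1))

theorem timeCutoff_contDiff (t : ℝ) (n : ℕ) : ContDiff ℝ ∞ (timeCutoff t n) :=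
  Real.smoothTransition.contDiff.comp ((contDiff_const.sub contDiff_id).mul contDiff_const)

theorem timeCutoff_eq_zero {t r : ℝ} (h : t ≤ r) (n : ℕ) : timeCutoff t n r = 0 :=
  Real.smoothTransition.zero_of_nonpos
    (mul_nonpos_of_nonpos_of_nonneg (sub_nonpos.2 h) (by positivity))

theorem timeCutoff_eq_one {t r : ℝ} {n : ℕ} (h : 1 / ((n : ℝ) + 1) ≤ t - r) :
    timeCutoff t n r = 1 :=
  Real.smoothTransition.one_of_one_le ((div_le_iff₀ (by positivity)).1 h)

theorem abs_timeCutoff_le_one (t : ℝ) (n : ℕ) (r : ℝ) : |timeCutoff t n r| ≤ 1 := by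
  rw [timeCutoff, abs_of_nonneg (Real.smoothTransition.nonneg _)]
  exact Real.smoothTransition.le_one _

theorem eventually_timeCutoff_eq_one {t r : ℝ} (h : r < t) :
    ∀ᶠ n : ℕ in atTop, timeCutoff t n r = 1 := by
  filter_upwards [tendsto_one_div_add_atTop_nhds_zero_nat.eventually_le_const (sub_pos.2 h)]
    with n hn using timeCutoff_eq_one hn

/-- The limit is `0` at `t` itself because every cut-off already vanishes there. This is what makes
the source act on `[a, t)`, without a possible atom at `t`. -/
theorem tendsto_timeCutoff (t r : ℝ) :
    Tendsto (fun n => timeCutoff t n r) atTop (𝓝 ((Set.Iio t).indicator 1 r)) := by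
  by_cases h : r < t
  · rw [Set.indicator_of_mem (show r ∈ Set.Iio t from h)]
    exact tendsto_const_nhds.congr' ((eventually_timeCutoff_eq_one h).mono fun _ hn => hn.symm)
  · rw [Set.indicator_of_notMem (show r ∉ Set.Iio t from h)]
    exact tendsto_const_nhds.congr fun n => (timeCutoff_eq_zero (not_lt.1 h) n).symm

theorem timeCutoff_antitone (t : ℝ) (n : ℕ) : Antitone (timeCutoff t n) := fun x y h =>
  Real.smoothTransition.monotone (by gcongr)

/-- The derivatives of the time cut-offs tend to minus the Dirac mass at `t`, from the left. -/
theorem tendsto_integral_deriv_timeCutoff {a b t : ℝ} (hat : a < t) (htb : t ≤ b) {A : ℝ → ℝ}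
    (hA : IntervalIntegrable A volume a b) (hcont : ContinuousWithinAt A (Set.Icc a t) t) :
    Tendsto (fun n => ∫ r in a..b, deriv (timeCutoff t n) r * A r) atTop (𝓝 (-A t)) := by
  have hab : a ≤ b := hat.le.trans htb
  have hcd (n : ℕ) : Continuous (deriv (timeCutoff t n)) :=
    (timeCutoff_contDiff t n).continuous_deriv (by simp)
  have htot (n : ℕ) : ∫ r in a..b, deriv (timeCutoff t n) r = - timeCutoff t n a := by
    rw [intervalIntegral.integral_deriv_eq_sub
      (fun x _ => ((timeCutoff_contDiff t n).differentiable (by simp)) x)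
      ((hcd n).intervalIntegrable _ _), timeCutoff_eq_zero htb, zero_sub]
  rw [Metric.tendsto_nhds]
  intro ε hε
  obtain ⟨δ, hδ, hδA⟩ := Metric.continuousWithinAt_iff.1 hcont (ε / 2) (half_pos hε)
  filter_upwards [eventually_timeCutoff_eq_one hat,
    tendsto_one_div_add_atTop_nhds_zero_nat.eventually_lt_const hδ,
    tendsto_one_div_add_atTop_nhds_zero_nat.eventually_lt_const (sub_pos.2 hat)] with n h1 h2 h3
  have hdiff : (∫ r in a..b, deriv (timeCutoff t n) r * A r) - -A t =
      ∫ r in a..b, deriv (timeCutoff t n) r * (A r - A t) := by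
    have e : ∫ r in a..b, deriv (timeCutoff t n) r * A t = -A t := by
      rw [intervalIntegral.integral_mul_const, htot, h1]; ring
    simp only [← e, mul_sub]
    exact (intervalIntegral.integral_sub (hA.continuousOn_mul (hcd n).continuousOn)
      (((hcd n).mul continuous_const).intervalIntegrable _ _)).symm
  -- The derivative vanishes outside `[t - 1 / (n + 1), t]`, so only values of `A` slightly to the
  -- left of `t` count and one-sided continuity suffices.
  have hpt : ∀ r ∈ Set.Ioc a b, ‖deriv (timeCutoff t n) r * (A r - A t)‖ ≤
      -deriv (timeCutoff t n) r * (ε / 2) := by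
    intro r hr
    have hneg : deriv (timeCutoff t n) r ≤ 0 := (timeCutoff_antitone t n).deriv_nonpos
    rcases lt_or_ge t r with htr | hrt
    · have : deriv (timeCutoff t n) r = 0 := by
        have : timeCutoff t n =ᶠ[𝓝 r] fun _ => 0 :=
          (eventually_gt_nhds htr).mono fun x hx => timeCutoff_eq_zero hx.le n
        rw [this.deriv_eq, deriv_const]
      simp [this]
    · rcases lt_or_ge r (t - 1 / ((n : ℝ) + 1)) with hlt | hge
      · have : deriv (timeCutoff t n) r = 0 := by
          have : timeCutoff t n =ᶠ[𝓝 r] fun _ => 1 :=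
            (eventually_lt_nhds hlt).mono fun x hx => timeCutoff_eq_one (by linarith)
          rw [this.deriv_eq, deriv_const]
        simp [this]
      · rw [norm_mul, Real.norm_of_nonpos hneg]
        refine mul_le_mul_of_nonneg_left ?_ (neg_nonneg.2 hneg)
        refine (hδA ⟨hr.1.le, hrt⟩ ?_).le
        rw [Real.dist_eq, abs_of_nonpos (by linarith)]
        linarith
  rw [Real.dist_eq, hdiff]
  calc _ ≤ ∫ r in a..b, -deriv (timeCutoff t n) r * (ε / 2) :=
        intervalIntegral.norm_integral_le_of_norm_le hab (Eventually.of_forall hpt)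
          (((hcd n).neg.mul continuous_const).intervalIntegrable _ _)
    _ = ε / 2 := by
        rw [intervalIntegral.integral_mul_const, intervalIntegral.integral_neg, htot, h1]; ring
    _ < ε := half_lt_self hε

/-! ### Smooth approximation with prescribed endpoint values. -/

/-- A function on a closed interval `D` of the line with Lipschitz constant and supremum at most `1`
is approximated locally uniformly by smooth functions of compact support that keep its values at `0`
and at the other endpoint `e`, and obey uniform bounds together with their derivatives. -/
theorem LipschitzOnWith.exists_contDiff_hasCompactSupport {D : Set ℝ} {e : ℝ} (h0 : 0 ∈ D)
    (he : e ∈ D) (hD : e = 0 ∨ D ⊆ Set.Icc 0 e) {h : ℝ → ℝ} (hlip : LipschitzOnWith 1 h D)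
    (hb : ∀ s ∈ D, |h s| ≤ 1) (R : ℝ) {ε : ℝ} (hε : 0 < ε) (hε1 : ε ≤ 1) :
    ∃ g : ℝ → ℝ, ContDiff ℝ ∞ g ∧ HasCompactSupport g ∧ (∀ s ∈ D, |g s| ≤ 2) ∧
      (∀ s ∈ D, |deriv g s| ≤ 4) ∧ g 0 = h 0 ∧ g e = h e ∧
      ∀ s ∈ D, |s| ≤ R → |g s - h s| ≤ ε := by
  obtain ⟨k, hk, hhk⟩ := hlip.extend_real
  -- The total error is `4 * δ`: `δ` from mollification, `δ` from the constant `c` and `2 * δ` from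
  -- the linear term. The condition `2 * δ ≤ |e|` keeps the slope of the latter at most `1`.
  obtain ⟨δ, hδ, hδε, hδe⟩ : ∃ δ > 0, 4 * δ ≤ ε ∧ (e = 0 ∨ 2 * δ ≤ |e|) := by
    by_cases hz : e = 0
    · exact ⟨ε / 4, by positivity, by linarith, Or.inl hz⟩
    · have := abs_pos.2 hz
      exact ⟨min (ε / 4) (|e| / 2), by positivity,
        by linarith [min_le_left (ε / 4) (|e| / 2)],
        Or.inr (by linarith [min_le_right (ε / 4) (|e| / 2)])⟩
  obtain ⟨f, hf, hfk, hfl⟩ := hk.exists_contDiff_dist_le hδ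
  obtain ⟨χ, hχ, hχc, hχI, hχ1, hχd⟩ := exists_smooth_cutoff (max R |e|) one_pos
  have hfh : ∀ s ∈ D, |f s - h s| ≤ δ := fun s hs => by
    rw [hhk hs]; simpa using hfk s
  -- The affine function `c + c' * s` restores the values of `h` at `0` and `e`. If `e = 0`,
  -- division by zero gives `c' = 0`, which is the right slope for a single endpoint.
  let c := h 0 - f 0
  let c' := ((h e - f e) - c) / e
  have hc : |c| ≤ δ := by rw [abs_sub_comm]; exact hfh 0 h0
  have hnum : |(h e - f e) - c| ≤ 2 * δ := by
    have h1 := hfh e he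
    rw [abs_sub_comm] at h1
    linarith [abs_sub (h e - f e) c]
  have hc' : |c'| ≤ 1 := by
    rcases hδe with hz | hz
    · simp [c', hz]
    · rw [abs_div, div_le_one (lt_of_lt_of_le (by positivity) hz)]
      exact hnum.trans hz
  have hc's : ∀ s ∈ D, |c' * s| ≤ 2 * δ := fun s hs => by
    by_cases hz : e = 0
    · simp only [c', hz, div_zero, zero_mul, abs_zero]; positivity
    · have hs' := (hD.resolve_left hz) hs
      have hepos : 0 < e := lt_of_le_of_ne (hs'.1.trans hs'.2) (Ne.symm hz)
      calc |c' * s| = |(h e - f e) - c| * (s / e) := by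
            rw [abs_mul, abs_div, abs_of_nonneg hs'.1, abs_of_pos hepos]; ring
        _ ≤ 2 * δ * 1 := mul_le_mul hnum ((div_le_one hepos).2 hs'.2)
            (div_nonneg hs'.1 hepos.le) (by positivity)
        _ = 2 * δ := mul_one _
  have hce : c + c' * e = h e - f e := by
    by_cases hz : e = 0
    · simp [c', c, hz]
    · simp only [c']; field_simp; ring
  let q := fun s => f s + (c + c' * s)
  have hq : ContDiff ℝ ∞ q := by fun_prop
  have hqh : ∀ s ∈ D, |q s - h s| ≤ ε := fun s hs => by
    have : q s - h s = (f s - h s) + (c + c' * s) := by simp only [q]; ring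
    rw [this]
    linarith [abs_add_le (f s - h s) (c + c' * s), abs_add_le c (c' * s), hfh s hs, hc's s hs]
  have hq2 : ∀ s ∈ D, |q s| ≤ 2 := fun s hs => by
    have := abs_sub_abs_le_abs_sub (q s) (h s)
    linarith [hqh s hs, hb s hs]
  have hχabs (s : ℝ) : |χ s| ≤ 1 := by rw [abs_of_nonneg (hχI s).1]; exact (hχI s).2
  refine ⟨fun s => χ s * q s, hχ.mul hq, hχc.mul_right, fun s hs => ?_, fun s hs => ?_, ?_, ?_,
    fun s hs hsR => ?_⟩
  · rw [abs_mul]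
    nlinarith [hq2 s hs, hχabs s, abs_nonneg (q s), abs_nonneg (χ s)]
  · have hfd := (hf.differentiable (by simp) s).hasDerivAt
    have hqd : HasDerivAt q (deriv f s + c') s :=
      hfd.add (by simpa using ((hasDerivAt_id s).const_mul c').const_add c)
    have hd := ((hχ.differentiable (by simp) s).hasDerivAt.mul hqd).deriv
    have hf1 : |deriv f s| ≤ 1 := by simpa using norm_deriv_le_of_lipschitz (x₀ := s) hfl
    rw [show (fun s => χ s * q s) = χ * q from rfl, hd]
    have h1 : |deriv χ s * q s| ≤ 1 * 2 := by
      rw [abs_mul]; exact mul_le_mul (hχd s) (hq2 s hs) (abs_nonneg _) zero_le_one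
    have h2 : |χ s * (deriv f s + c')| ≤ 1 * 2 := by
      rw [abs_mul]
      exact mul_le_mul (hχabs s) (by linarith [abs_add_le (deriv f s) c']) (abs_nonneg _)
        zero_le_one
    linarith [abs_add_le (deriv χ s * q s) (χ s * (deriv f s + c'))]
  · simp [q, c, hχ1 0 (by simp)]
  · simp [q, hce, hχ1 e (le_max_right _ _)]
  · simpa [hχ1 s (hsR.trans (le_max_left _ _))] using hqh s hs

/-! ## Geometry of networks -/

namespace ArcType

variable {V : Type} (A : ArcType V)

theorem isClosed_dom : IsClosed A.dom := by
  cases A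
  exacts [isClosed_Icc, isClosed_Ici, isClosed_Iic]

theorem measurableSet_dom : MeasurableSet A.dom := A.isClosed_dom.measurableSet

theorem convex_dom : Convex ℝ A.dom := by
  cases A
  exacts [convex_Icc _ _, convex_Ici _, convex_Iic _]

/-- The dichotomy needed for the endpoint correction: a ray has its only endpoint at `0`, while on a
bounded arc the parameter stays between the two endpoints, so the linear correction stays small. -/
theorem endParam_eq_zero_or : A.endParam = 0 ∨ A.dom ⊆ Set.Icc 0 A.endParam := by
  cases A
  exacts [Or.inr subset_rfl, Or.inl rfl, Or.inl rfl]

end ArcType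

namespace Network

variable {V E : Type} [Fintype V] [Fintype E] {d : ℕ} (Γ : Network V E d)

theorem zero_mem_dom (j : E) : (0 : ℝ) ∈ (Γ.arc j).dom := by
  have h := Γ.length_pos j
  cases hA : Γ.arc j with
  | bounded x y L => exact ⟨le_rfl, (h x y L hA).le⟩
  | outRay x => exact Set.self_mem_Ici
  | inRay y => exact Set.self_mem_Iic

theorem endParam_mem_dom (j : E) : (Γ.arc j).endParam ∈ (Γ.arc j).dom := by
  have h := Γ.length_pos j
  cases hA : Γ.arc j with
  | bounded x y L => exact ⟨(h x y L hA).le, le_rfl⟩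
  | outRay x => exact Set.self_mem_Ici
  | inRay y => exact Set.self_mem_Iic

theorem param_mem_carrier (j : E) {s : ℝ} (hs : s ∈ (Γ.arc j).dom) : Γ.param j s ∈ Γ.carrier :=
  Set.mem_iUnion_of_mem j (Set.mem_image_of_mem _ hs)

theorem pos_mem_carrier (x : V) : Γ.pos x ∈ Γ.carrier := by
  obtain ⟨j, hj⟩ := Γ.no_sink x
  rw [← Γ.param_source j x hj]
  exact Γ.param_mem_carrier j (Γ.zero_mem_dom j)

theorem continuous_param (j : E) : Continuous (Γ.param j) := (Γ.param_smooth j).continuous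

/-- Closed subsets of the line are σ-compact, and continuous images of σ-compact sets are countable
unions of compact sets. -/
theorem measurableSet_param_image (j : E) {C : Set ℝ} (hC : IsClosed C) :
    MeasurableSet (Γ.param j '' C) := by
  obtain ⟨K, hK, hU⟩ := (isSigmaCompact_univ.of_isClosed_subset hC (Set.subset_univ C)).image
    (Γ.continuous_param j)
  rw [← hU]
  exact MeasurableSet.iUnion fun n => (hK n).measurableSet

theorem measurableSet_carrier : MeasurableSet Γ.carrier :=
  MeasurableSet.iUnion fun j => Γ.measurableSet_param_image j (Γ.arc j).isClosed_dom

theorem lipschitzOnWith_param (j : E) : LipschitzOnWith 1 (Γ.param j) (Γ.arc j).dom :=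
  (Γ.arc j).convex_dom.lipschitzOnWith_of_nnnorm_deriv_le
    (fun s _ => (Γ.param_smooth j).differentiable (by simp) s)
    fun s hs => by rw [← NNReal.coe_le_coe, coe_nnnorm, Γ.param_unit_speed j s hs]; simp

/-- The path distance is bounded by the arc length. -/
theorem pathDist_param_le (j : E) {s s' : ℝ} (hs : s ∈ (Γ.arc j).dom)
    (hs' : s' ∈ (Γ.arc j).dom) :
    Γ.pathDist (Γ.param j s) (Γ.param j s') ≤ edist s s' := by
  have hmaps : Set.MapsTo (fun r : ℝ => AffineMap.lineMap s s' r) (Set.Icc 0 1) (Γ.arc j).dom :=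
    fun r hr => (Γ.arc j).convex_dom.lineMap_mem hs hs' hr
  have hlin : LipschitzWith (nndist s s') (fun r : ℝ => (AffineMap.lineMap s s' r : ℝ)) :=
    LipschitzWith.of_dist_le_mul fun x y => by
      rw [dist_lineMap_lineMap, mul_comm]; rfl
  have hlip : LipschitzOnWith (nndist s s') (fun r : ℝ => Γ.param j (AffineMap.lineMap s s' r))
      (Set.Icc 0 1) := by
    have := (Γ.lipschitzOnWith_param j).comp hlin.lipschitzOnWith hmaps
    rwa [one_mul] at this
  refine iInf_le_of_le (fun r : ℝ => Γ.param j (AffineMap.lineMap s s' r)) ?_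
  refine iInf_le_of_le hlip.continuousOn ?_
  refine iInf_le_of_le (fun r hr => Γ.param_mem_carrier j (hmaps hr)) ?_
  refine iInf_le_of_le (congrArg _ (AffineMap.lineMap_apply_zero _ _)) ?_
  refine iInf_le_of_le (congrArg _ (AffineMap.lineMap_apply_one _ _)) ?_
  calc eVariationOn (fun r : ℝ => Γ.param j (AffineMap.lineMap s s' r)) (Set.Icc 0 1)
      ≤ nndist s s' * eVariationOn (fun r : ℝ => r) (Set.Icc 0 1) :=
        hlip.comp_eVariationOn_le (Set.mapsTo_id _)
    _ ≤ nndist s s' * ENNReal.ofReal (1 - 0) := by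
        have := (monotone_id.monotoneOn (Set.Icc (0 : ℝ) 1)).eVariationOn_eq
          (Set.left_mem_Icc.2 zero_le_one) (Set.right_mem_Icc.2 zero_le_one)
        rw [Set.inter_self] at this
        exact mul_le_mul_right this.le _
    _ = edist s s' := by rw [edist_nndist, sub_zero, ENNReal.ofReal_one, mul_one]

/-! ## Bounded Lipschitz functions on the network -/

theorem enorm_le_one_of_blNorm_le_one {X : Type*} {S : Set X} {ρ : X → X → ℝ≥0∞} {f : X → ℝ}
    (hf : blNorm S ρ f ≤ 1) {x : X} (hx : x ∈ S) : ‖f x‖ₑ ≤ 1 :=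
  (le_iSup₂ (f := fun x _ => ‖f x‖ₑ) x hx).trans ((le_add_right le_rfl).trans hf)

theorem enorm_sub_le_of_blNorm_le_one {X : Type*} {S : Set X} {ρ : X → X → ℝ≥0∞} {f : X → ℝ}
    (hf : blNorm S ρ f ≤ 1) {x y : X} (hx : x ∈ S) (hy : y ∈ S) : ‖f x - f y‖ₑ ≤ ρ x y := by
  by_cases hxy : x = y
  · simp [hxy]
  have h : ‖f x - f y‖ₑ / ρ x y ≤ 1 := by
    refine le_trans ?_ ((le_add_left le_rfl).trans hf)
    exact le_iSup₂_of_le x hx (le_iSup₂_of_le y hy (le_iSup_of_le hxy le_rfl))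
  -- A nonzero numerator over `0` is `⊤`, contradicting the bound on the quotient; at infinite
  -- distance nothing is claimed.
  by_cases h0 : ρ x y = 0
  · by_contra hne
    rw [h0, ENNReal.div_zero (by simpa [h0] using hne)] at h
    simp at h
  · by_cases ht : ρ x y = ⊤
    · simp [ht]
    · simpa using (ENNReal.div_le_iff h0 ht).1 h

variable {Γ}

theorem abs_comp_param_le_one {f : EuclideanSpace ℝ (Fin d) → ℝ}
    (hf : blNorm Γ.carrier Γ.pathDist f ≤ 1) (j : E) {s : ℝ} (hs : s ∈ (Γ.arc j).dom) :
    |f (Γ.param j s)| ≤ 1 := by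
  have := enorm_le_one_of_blNorm_le_one hf (Γ.param_mem_carrier j hs)
  rw [Real.enorm_eq_ofReal_abs] at this
  simpa using this

theorem lipschitzOnWith_comp_param {f : EuclideanSpace ℝ (Fin d) → ℝ}
    (hf : blNorm Γ.carrier Γ.pathDist f ≤ 1) (j : E) :
    LipschitzOnWith 1 (fun s => f (Γ.param j s)) (Γ.arc j).dom := fun s hs s' hs' => by
  rw [edist_eq_enorm_sub, ENNReal.coe_one, one_mul]
  exact (enorm_sub_le_of_blNorm_le_one hf (Γ.param_mem_carrier j hs)
    (Γ.param_mem_carrier j hs')).trans (Γ.pathDist_param_le j hs hs')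

/-- The test functions in `blDist` are not assumed Borel. Continuity along the arcs suffices: the
part of a closed preimage inside the network is a finite union of images of closed parameter sets.
-/
theorem measurable_indicator_carrier {f : EuclideanSpace ℝ (Fin d) → ℝ}
    (hf : ∀ j, ContinuousOn (fun s => f (Γ.param j s)) (Γ.arc j).dom) :
    Measurable (Γ.carrier.indicator f) := by
  have hpre (C : Set ℝ) : Γ.carrier ∩ f ⁻¹' C =
      ⋃ j, Γ.param j '' ((Γ.arc j).dom ∩ (fun s => f (Γ.param j s)) ⁻¹' C) := by
    rw [carrier, Set.iUnion_inter]
    exact Set.iUnion_congr fun j => (Set.image_inter_preimage _ _ _).symm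
  refine measurable_of_isClosed fun C hC => ?_
  rw [Set.indicator_preimage, Set.ite, Set.inter_comm, hpre]
  refine (MeasurableSet.iUnion fun j => Γ.measurableSet_param_image j
    ((hf j).preimage_isClosed_of_isClosed (Γ.arc j).isClosed_dom hC)).union
    (MeasurableSet.diff ?_ Γ.measurableSet_carrier)
  exact measurable_const hC.measurableSet

/-! ## Measures on the network -/

theorem IsArcFamily.ae_mem_dom {m : E → Measure ℝ} (hm : Γ.IsArcFamily m) (j : E) :
    ∀ᵐ s ∂(m j), s ∈ (Γ.arc j).dom := (hm j).2

theorem toMeasure_apply (m : E → Measure ℝ) {A : Set (EuclideanSpace ℝ (Fin d))}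
    (hA : MeasurableSet A) : Γ.toMeasure m A = ∑ j, m j (Γ.param j ⁻¹' A) := by
  simp only [toMeasure, Measure.coe_finsetSum, Finset.sum_apply]
  exact Finset.sum_congr rfl fun j _ => Measure.map_apply (Γ.continuous_param j).measurable hA

theorem toMeasure_univ (m : E → Measure ℝ) : Γ.toMeasure m Set.univ = ∑ j, m j Set.univ := by
  rw [toMeasure_apply m MeasurableSet.univ]; rfl

theorem IsArcFamily.isMeasureOn {m : E → Measure ℝ} (hm : Γ.IsArcFamily m) :
    Γ.IsMeasureOn (Γ.toMeasure m) := by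
  refine ⟨⟨?_⟩, ?_⟩
  · rw [toMeasure_univ]
    exact ENNReal.sum_lt_top.2 fun j _ => have := (hm j).1; measure_lt_top _ _
  · rw [toMeasure_apply m Γ.measurableSet_carrier.compl]
    refine Finset.sum_eq_zero fun j _ => measure_mono_null ?_ (hm j).2
    exact fun s hs hd => hs (Γ.param_mem_carrier j hd)

theorem IsArcFamily.setIntegral_toMeasure {m : E → Measure ℝ} (hm : Γ.IsArcFamily m)
    {f : EuclideanSpace ℝ (Fin d) → ℝ} (hf : blNorm Γ.carrier Γ.pathDist f ≤ 1) :
    ∫ x in Γ.carrier, f x ∂(Γ.toMeasure m) = ∑ j, ∫ s, f (Γ.param j s) ∂(m j) := by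
  have hmeas := measurable_indicator_carrier fun j => (lipschitzOnWith_comp_param hf j).continuousOn
  have hbound (x) : ‖Γ.carrier.indicator f x‖ ≤ 1 := by
    by_cases hx : x ∈ Γ.carrier
    · rw [Set.indicator_of_mem hx]
      have := enorm_le_one_of_blNorm_le_one hf hx
      rw [Real.enorm_eq_ofReal_abs] at this
      simpa using this
    · simp [hx]
  rw [← integral_indicator Γ.measurableSet_carrier, toMeasure, integral_finsetSum_measure]
  · refine Finset.sum_congr rfl fun j _ => ?_
    rw [integral_map (Γ.continuous_param j).aemeasurable hmeas.aestronglyMeasurable]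
    refine integral_congr_ae ((hm.ae_mem_dom j).mono fun s hs => ?_)
    exact Set.indicator_of_mem (Γ.param_mem_carrier j hs) f
  · intro j _
    have := (hm j).1
    exact Integrable.of_bound hmeas.aestronglyMeasurable 1 (Eventually.of_forall hbound)

theorem bl_zero_le (μ : Measure (EuclideanSpace ℝ (Fin d))) : Γ.bl μ 0 ≤ μ Set.univ := by
  refine iSup₂_le fun f hf => ?_
  rw [Measure.restrict_zero, integral_zero_measure, sub_zero]
  calc _ ≤ ∫⁻ x in Γ.carrier, ‖f x‖ₑ ∂μ := enorm_integral_le_lintegral_enorm _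
    _ ≤ ∫⁻ _ in Γ.carrier, 1 ∂μ := setLIntegral_mono' Γ.measurableSet_carrier
        fun x hx => enorm_le_one_of_blNorm_le_one hf hx
    _ ≤ μ Set.univ := by simpa using measure_mono (Set.subset_univ _)

/-- The constant `1` has no Lipschitz part, so it is an admissible test function. -/
theorem le_blDist_zero {X : Type*} [MeasurableSpace X] (S : Set X) (ρ : X → X → ℝ≥0∞)
    (μ : Measure X) [IsFiniteMeasure μ] : μ S ≤ blDist S ρ μ 0 := by
  have h1 : blNorm S ρ (fun _ => (1 : ℝ)) ≤ 1 := by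
    simp only [blNorm, sub_self, enorm_zero, ENNReal.zero_div, ENNReal.iSup_zero, add_zero]
    exact iSup₂_le fun x _ => by simp
  refine le_trans ?_ (le_iSup₂ (fun _ : X => (1 : ℝ)) h1)
  simp [Measure.real, Real.enorm_eq_ofReal_abs]

theorem IsArcFamily.univ_le_bl {m : E → Measure ℝ} (hm : Γ.IsArcFamily m) :
    Γ.toMeasure m Set.univ ≤ Γ.bl (Γ.toMeasure m) 0 := by
  have := hm.isMeasureOn.1
  rw [← measure_add_measure_compl Γ.measurableSet_carrier, hm.isMeasureOn.2, add_zero]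
  exact le_blDist_zero _ _ _

theorem sum_le_blSpaceTime {T : ℝ} {σ : V → Measure ℝ} (hσ : ∀ x, IsFiniteMeasure (σ x)) :
    ∑ x, σ x (Set.Icc 0 T) ≤ Γ.blSpaceTime T (Γ.sourceMeasure σ) 0 := by
  have hmeas (x : V) : Measurable fun t : ℝ => (Γ.pos x, t) := measurable_prodMk_left
  have : IsFiniteMeasure (Γ.sourceMeasure σ) := by
    unfold sourceMeasure; infer_instance
  refine le_trans (le_of_eq ?_) (le_blDist_zero _ _ _)
  simp only [sourceMeasure, Measure.coe_finsetSum, Finset.sum_apply]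
  refine Finset.sum_congr rfl fun x _ => ?_
  rw [Measure.map_apply (hmeas x) (Γ.measurableSet_carrier.prod measurableSet_Icc)]
  congr 1
  ext t
  simp [Γ.pos_mem_carrier x]

theorem bl_triangle (μ ν κ : Measure (EuclideanSpace ℝ (Fin d))) :
    Γ.bl μ κ ≤ Γ.bl μ ν + Γ.bl ν κ := by
  refine iSup₂_le fun f hf => ?_
  refine le_trans ?_ (add_le_add (le_iSup₂ (f := fun (f : EuclideanSpace ℝ (Fin d) → ℝ)
    (_ : blNorm Γ.carrier Γ.pathDist f ≤ 1) => _) f hf) (le_iSup₂ (f := fun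
    (f : EuclideanSpace ℝ (Fin d) → ℝ) (_ : blNorm Γ.carrier Γ.pathDist f ≤ 1) => _) f hf))
  refine le_trans (le_of_eq ?_) (enorm_add_le _ _)
  congr 1
  ring

end Network

/-! ## The linear problem tested with time-independent functions -/

namespace Network

variable {V E : Type} [Fintype V] [Fintype E] {d : ℕ} {Γ : Network V E d}

variable (Γ) in
/-- A time-independent test function of compact support: the family `F` of its restrictions to the
arcs and its values `W` at the vertices. -/
structure IsStaticTest (F : E → ℝ → ℝ) (W : V → ℝ) : Prop where
  smooth : ∀ j, ContDiff ℝ ∞ (F j)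
  compact : ∀ j, HasCompactSupport (F j)
  source_match : ∀ j x, (Γ.arc j).source = some x → F j 0 = W x
  target_match : ∀ j x, (Γ.arc j).target = some x → F j (Γ.arc j).endParam = W x

namespace IsStaticTest

variable {F : E → ℝ → ℝ} {W : V → ℝ}

theorem exists_bound (hF : Γ.IsStaticTest F W) (j : E) : ∃ C, ∀ s, |F j s| ≤ C :=
  (hF.compact j).exists_bound_of_continuous (hF.smooth j).continuous

theorem continuous_deriv (hF : Γ.IsStaticTest F W) (j : E) : Continuous (deriv (F j)) :=
  (hF.smooth j).continuous_deriv (by simp)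

theorem exists_bound_deriv (hF : Γ.IsStaticTest F W) (j : E) : ∃ C, ∀ s, |deriv (F j) s| ≤ C :=
  (hF.compact j).deriv.exists_bound_of_continuous (hF.continuous_deriv j)

/-- The product of a time-independent test function and a smooth function of time. -/
theorem isTest_mul (hF : Γ.IsStaticTest F W) (a b : ℝ) {φ : ℝ → ℝ} (hφ : ContDiff ℝ ∞ φ) :
    Γ.IsTest a b (fun j s t => F j s * φ t) (fun x t => W x * φ t) := by
  refine ⟨fun j => ⟨?_, fun ε hε => ?_, ?_⟩, fun j x h t _ => ?_, fun j x h t _ => ?_⟩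
  · exact ((hF.smooth j).comp contDiff_fst).mul (hφ.comp contDiff_snd)
  · obtain ⟨R, hR⟩ := (hF.compact j).isCompact.isBounded.subset_closedBall 0
    refine ⟨R + 1, fun s _ hs t _ => ?_⟩
    have : F j s = 0 := image_eq_zero_of_notMem_tsupport fun h => by
      have := hR h
      rw [Metric.mem_closedBall, dist_zero_right, Real.norm_eq_abs] at this
      linarith
    simp [this, hε.le]
  · obtain ⟨C, hC⟩ := hF.exists_bound j
    obtain ⟨C', hC'⟩ := hF.exists_bound_deriv j
    obtain ⟨M, hM⟩ := isCompact_Icc.exists_bound_of_continuousOn (s := Set.Icc a b)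
      hφ.continuous.continuousOn
    obtain ⟨M', hM'⟩ := isCompact_Icc.exists_bound_of_continuousOn (s := Set.Icc a b)
      (hφ.continuous_deriv (by simp)).continuousOn
    refine ⟨max (C' * M) (C * M'), fun s _ t ht => ⟨le_max_of_le_left ?_, le_max_of_le_right ?_⟩⟩
    · rw [deriv_mul_const_field, abs_mul]
      exact mul_le_mul (hC' s) (hM t ht) (abs_nonneg _) ((abs_nonneg _).trans (hC' s))
    · rw [deriv_const_mul_field, abs_mul]
      exact mul_le_mul (hC s) (hM' t ht) (abs_nonneg _) ((abs_nonneg _).trans (hC s))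
  · rw [hF.source_match j x h]
  · rw [hF.target_match j x h]

end IsStaticTest

variable {a b : ℝ} {u : E → ℝ → ℝ} {σ : V → Measure ℝ} {p : E → E → ℝ → ℝ}
  {m : ℝ → E → Measure ℝ}

theorem IsArcFamily.integrable {μ : E → Measure ℝ} (hμ : Γ.IsArcFamily μ) {j : E} {k : ℝ → ℝ}
    {C : ℝ} (hk : ContinuousOn k (Γ.arc j).dom) (hC : ∀ s ∈ (Γ.arc j).dom, |k s| ≤ C) :
    Integrable k (μ j) := by
  have := (hμ j).1
  rw [← Measure.restrict_eq_self_of_ae_mem (hμ.ae_mem_dom j)]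
  refine Integrable.of_bound (hk.aestronglyMeasurable (Γ.arc j).measurableSet_dom) C ?_
  exact (ae_restrict_mem (Γ.arc j).measurableSet_dom).mono hC

theorem IsArcFamily.abs_integral_le {μ : E → Measure ℝ} (hμ : Γ.IsArcFamily μ) {j : E} {k : ℝ → ℝ}
    {C : ℝ} (hC : ∀ s ∈ (Γ.arc j).dom, |k s| ≤ C) :
    |∫ s, k s ∂(μ j)| ≤ C * (μ j).real Set.univ := by
  have := (hμ j).1
  exact norm_integral_le_of_norm_le_const (f := k) ((hμ.ae_mem_dom j).mono hC)

/-! ### Balance and estimates on one time step. -/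

namespace IsLinearSolution

theorem aemeasurable_measure (h : Γ.IsLinearSolution a b u σ p m) (j : E) :
    AEMeasurable (fun r => m r j) (volume.restrict (Set.Icc a b)) :=
  (aemeasurable_restrict_iff_comap_subtype measurableSet_Icc).2 (h.measurable j).aemeasurable

theorem integrableOn_mass (h : Γ.IsLinearSolution a b u σ p m) (j : E) :
    IntegrableOn (fun r => (m r j).real Set.univ) (Set.Icc a b) :=
  integrable_toReal_of_lintegral_ne_top
    ((Measure.measurable_coe MeasurableSet.univ).comp_aemeasurable (h.aemeasurable_measure j))
    (h.finite j).ne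

/-- Measurability in time is available for integrals of nonnegative measurable functions, so `k` is
cut off to the arc and split into positive and negative parts. The mass, integrable in time,
dominates. -/
theorem integrableOn_integral (h : Γ.IsLinearSolution a b u σ p m) {j : E} {k : ℝ → ℝ}
    {C : ℝ} (hk : ContinuousOn k (Γ.arc j).dom) (hC : ∀ s ∈ (Γ.arc j).dom, |k s| ≤ C) :
    IntegrableOn (fun r => ∫ s, k s ∂(m r j)) (Set.Icc a b) := by
  have hmem := ae_restrict_mem (μ := (volume : Measure ℝ)) (measurableSet_Icc (a := a) (b := b))
  refine Integrable.mono' ((h.integrableOn_mass j).const_mul C) (AEMeasurable.aestronglyMeasurable ?_)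
    (hmem.mono fun r hr => (h.arcFamily r hr).abs_integral_le hC)
  let q := (Γ.arc j).dom.indicator k
  have hq : Measurable q := by
    classical
    rw [show q = (Γ.arc j).dom.piecewise k 0 from Set.piecewise_eq_indicator.symm]
    exact hk.measurable_piecewise continuousOn_const (Γ.arc j).measurableSet_dom
  have hlin {f : ℝ → ℝ≥0∞} (hf : Measurable f) : AEMeasurable (fun r => ∫⁻ s, f s ∂(m r j))
      (volume.restrict (Set.Icc a b)) :=
    (Measure.measurable_lintegral hf).comp_aemeasurable (h.aemeasurable_measure j)
  refine ((hlin hq.ennreal_ofReal).ennreal_toReal.sub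
    (hlin hq.neg.ennreal_ofReal).ennreal_toReal).congr (hmem.mono fun r hr => ?_)
  have hkq : k =ᵐ[m r j] q := ((h.arcFamily r hr).ae_mem_dom j).mono fun s hs =>
    (Set.indicator_of_mem hs k).symm
  have hint := ((h.arcFamily r hr).integrable hk hC).congr hkq
  simp only [Pi.sub_apply]
  rw [integral_congr_ae hkq, integral_eq_lintegral_pos_part_sub_lintegral_neg_part hint]
  rfl

theorem intervalIntegrable_flux (h : Γ.IsLinearSolution a b u σ p m) (hab : a ≤ b)
    (hu : ∀ j, ContinuousOn (u j) (Γ.arc j).dom) {K : ℝ}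
    (huK : ∀ j, ∀ s ∈ (Γ.arc j).dom, |u j s| ≤ K) {F : E → ℝ → ℝ} {W : V → ℝ}
    (hF : Γ.IsStaticTest F W) (j : E) :
    IntervalIntegrable (fun r => ∫ s, u j s * deriv (F j) s ∂(m r j)) volume a b := by
  obtain ⟨C, hC⟩ := hF.exists_bound_deriv j
  refine (intervalIntegrable_iff_integrableOn_Icc_of_le hab).2 (h.integrableOn_integral (C := K * C)
    ((hu j).mul (hF.continuous_deriv j).continuousOn) fun s hs => ?_)
  rw [abs_mul]
  exact mul_le_mul (huK j s hs) (hC s) (abs_nonneg _) ((abs_nonneg _).trans (huK j s hs))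

/-- The balance of a time-independent test function on `[a, t)`. -/
theorem static_balance (h : Γ.IsLinearSolution a b u σ p m) [∀ x, IsFiniteMeasure (σ x)]
    (hu : ∀ j, ContinuousOn (u j) (Γ.arc j).dom) {K : ℝ}
    (huK : ∀ j, ∀ s ∈ (Γ.arc j).dom, |u j s| ≤ K) {F : E → ℝ → ℝ} {W : V → ℝ}
    (hF : Γ.IsStaticTest F W) {t : ℝ} (ht : t ∈ Set.Ioc a b) :
    (∑ j, ∫ s, F j s ∂(m t j)) - ∑ j, ∫ s, F j s ∂(m a j) =
      (∑ x, W x * (σ x).real (Set.Ico a t)) +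
        ∫ r in a..t, ∑ j, ∫ s, u j s * deriv (F j) s ∂(m r j) := by
  have hab : a ≤ b := ht.1.le.trans ht.2
  let A := fun r => ∑ j, ∫ s, F j s ∂(m r j)
  let B := fun r => ∑ j, ∫ s, u j s * deriv (F j) s ∂(m r j)
  choose C hC using hF.exists_bound
  choose C' hC' using hF.exists_bound_deriv
  have hcont (j : E) : ContinuousOn (fun s => u j s * deriv (F j) s) (Γ.arc j).dom :=
    (hu j).mul (hF.continuous_deriv j).continuousOn
  have hbd (j : E) : ∀ s ∈ (Γ.arc j).dom, |u j s * deriv (F j) s| ≤ K * C' j := fun s hs => by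
    rw [abs_mul]
    exact mul_le_mul (huK j s hs) (hC' j s) (abs_nonneg _) ((abs_nonneg _).trans (huK j s hs))
  have hAI (j : E) : IntervalIntegrable (fun r => ∫ s, F j s ∂(m r j)) volume a b :=
    (intervalIntegrable_iff_integrableOn_Icc_of_le hab).2
      (h.integrableOn_integral (hF.smooth j).continuous.continuousOn fun s _ => hC j s)
  have hBI := h.intervalIntegrable_flux hab hu huK hF
  have hA : IntervalIntegrable A volume a b := by
    simpa [A, Finset.sum_fn] using IntervalIntegrable.sum Finset.univ fun j _ => hAI j
  have hB : IntervalIntegrable B volume a b := by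
    simpa [B, Finset.sum_fn] using IntervalIntegrable.sum Finset.univ fun j _ => hBI j
  -- Products `F(x) φ(t)` reduce the weak equation to one in time alone: the derivative of `A` is
  -- the weighted source plus `B`.
  have key {φ : ℝ → ℝ} (hφ : ContDiff ℝ ∞ φ) : A b * φ b - A a * φ a =
      (∑ x, W x * ∫ r in Set.Ico a b, φ r ∂(σ x)) +
        ((∫ r in a..b, deriv φ r * A r) + ∫ r in a..b, φ r * B r) := by
    have hφ' : Continuous (deriv φ) := hφ.continuous_deriv (by simp)
    have htr (j : E) : transportTerm a b (u j) (fun t => m t j) (fun s r => F j s * φ r) =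
        (∫ r in a..b, deriv φ r * ∫ s, F j s ∂(m r j)) +
          ∫ r in a..b, φ r * ∫ s, u j s * deriv (F j) s ∂(m r j) := by
      rw [← intervalIntegral.integral_add ((hAI j).continuousOn_mul hφ'.continuousOn)
        ((hBI j).continuousOn_mul hφ.continuous.continuousOn)]
      refine intervalIntegral.integral_congr fun r hr => ?_
      rw [Set.uIcc_of_le hab] at hr
      have hfam := h.arcFamily r hr
      simp only [deriv_const_mul_field, deriv_mul_const_field]
      rw [← integral_const_mul, ← integral_const_mul, ← integral_add
        ((hfam.integrable (hF.smooth j).continuous.continuousOn fun s _ => hC j s).const_mul _)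
        ((hfam.integrable (hcont j) (hbd j)).const_mul _)]
      exact integral_congr_ae (Eventually.of_forall fun s => by ring)
    have hbal := h.balance _ _ (hF.isTest_mul a b hφ)
    simp only [integral_mul_const, integral_const_mul, htr, ← Finset.sum_mul,
      Finset.sum_add_distrib] at hbal
    rw [hbal]
    congr 2
    · rw [← intervalIntegral.integral_finsetSum
        fun j _ => (hAI j).continuousOn_mul hφ'.continuousOn]
      simp only [A, Finset.mul_sum]
    · rw [← intervalIntegral.integral_finsetSum
        fun j _ => (hBI j).continuousOn_mul hφ.continuous.continuousOn]
      simp only [B, Finset.mul_sum]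
  -- Left continuity is available only at interior times. At the right end of the step `φ = 1`
  -- already gives the claim.
  rcases ht.2.eq_or_lt with rfl | htb
  · have := key (φ := fun _ => 1) contDiff_const
    simpa [A, B] using this
  · have hcontA : ContinuousWithinAt A (Set.Icc a t) t := by
      simpa [A] using h.left_continuous _ _ (hF.isTest_mul a b (φ := fun _ => 1) contDiff_const)
        t ⟨ht.1, htb⟩
    have hm (n : ℕ) := (timeCutoff_contDiff t n).continuous
    have l1 := tendsto_integral_deriv_timeCutoff ht.1 ht.2 hA hcontA
    have l2 : Tendsto (fun n => ∫ r in a..b, timeCutoff t n r * B r) atTop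
        (𝓝 (∫ r in a..t, B r)) := by
      have e : ∫ r in a..t, B r = ∫ r in a..b, (Set.Iio t).indicator 1 r * B r := by
        rw [intervalIntegral.integral_of_le ht.1.le, intervalIntegral.integral_of_le hab,
          integral_Ioc_eq_integral_Ioo]
        have : ∀ r, (Set.Iio t).indicator 1 r * B r = (Set.Iio t).indicator B r := fun r => by
          by_cases hr : r ∈ Set.Iio t <;> simp [hr]
        simp only [this]
        rw [setIntegral_indicator measurableSet_Iio]
        congr 2
        ext r
        simp only [Set.mem_Ioo, Set.mem_inter_iff, Set.mem_Ioc, Set.mem_Iio]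
        exact ⟨fun hr => ⟨⟨hr.1, hr.2.le.trans ht.2⟩, hr.2⟩, fun hr => ⟨hr.1.1, hr.2⟩⟩
      rw [e]
      refine intervalIntegral.tendsto_integral_filter_of_dominated_convergence (fun r => |B r|)
        (Eventually.of_forall fun n => ?_) (Eventually.of_forall fun n => ae_of_all _ fun r _ => ?_)
        hB.norm (ae_of_all _ fun r _ => (tendsto_timeCutoff t r).mul_const _)
      · exact (hm n).aestronglyMeasurable.mul
          ((intervalIntegrable_iff.1 hB).aestronglyMeasurable)
      · rw [norm_mul]
        exact mul_le_of_le_one_left (abs_nonneg _) (abs_timeCutoff_le_one t n r)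
    have l3 (x : V) : Tendsto (fun n => ∫ r in Set.Ico a b, timeCutoff t n r ∂(σ x)) atTop
        (𝓝 ((σ x).real (Set.Ico a t))) := by
      have e : (σ x).real (Set.Ico a t) = ∫ r in Set.Ico a b, (Set.Iio t).indicator 1 r ∂(σ x) := by
        rw [integral_indicator_one measurableSet_Iio, measureReal_restrict_apply measurableSet_Iio]
        congr 1
        ext r
        simp only [Set.mem_Ico, Set.mem_inter_iff, Set.mem_Iio]
        exact ⟨fun hr => ⟨hr.2, hr.1, hr.2.trans htb⟩, fun hr => ⟨hr.2.1, hr.1⟩⟩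
      rw [e]
      exact tendsto_integral_of_dominated_convergence (fun _ => 1)
        (fun n => (hm n).aestronglyMeasurable) (integrable_const _)
        (fun n => ae_of_all _ fun r => abs_timeCutoff_le_one t n r)
        (ae_of_all _ fun r => tendsto_timeCutoff t r)
    have l4 := (tendsto_finsetSum Finset.univ fun x _ => (l3 x).const_mul (W x)).add (l1.add l2)
    -- The cut-offs vanish at `b` and are eventually `1` at `a`, so the left side of `key` becomes
    -- `-A a`; the value `A t` comes from the limit `l1`.
    have l5 := l4.congr' (f₂ := fun _ => - A a) <| by
      filter_upwards [eventually_timeCutoff_eq_one ht.1] with n hn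
      rw [← key (timeCutoff_contDiff t n), hn, timeCutoff_eq_zero ht.2]
      ring
    have := tendsto_nhds_unique l5 tendsto_const_nhds
    change A t - A a = _ + ∫ r in a..t, B r
    linarith

/-- The balance of a time-independent test function on `[s, t)`. -/
theorem static_balance_Ico (h : Γ.IsLinearSolution a b u σ p m) [∀ x, IsFiniteMeasure (σ x)]
    (hu : ∀ j, ContinuousOn (u j) (Γ.arc j).dom) {K : ℝ}
    (huK : ∀ j, ∀ s ∈ (Γ.arc j).dom, |u j s| ≤ K) {F : E → ℝ → ℝ} {W : V → ℝ}
    (hF : Γ.IsStaticTest F W) {s t : ℝ} (has : a ≤ s) (hst : s < t) (htb : t ≤ b) :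
    (∑ j, ∫ y, F j y ∂(m t j)) - ∑ j, ∫ y, F j y ∂(m s j) =
      (∑ x, W x * (σ x).real (Set.Ico s t)) +
        ∫ r in s..t, ∑ j, ∫ y, u j y * deriv (F j) y ∂(m r j) := by
  have h1 := h.static_balance hu huK hF ⟨has.trans_lt hst, htb⟩
  rcases has.eq_or_lt with rfl | has'
  · exact h1
  have h2 := h.static_balance hu huK hF ⟨has', hst.le.trans htb⟩
  have hB : IntervalIntegrable (fun r => ∑ j, ∫ y, u j y * deriv (F j) y ∂(m r j)) volume a b := by
    simpa [Finset.sum_fn] using IntervalIntegrable.sum Finset.univ fun j _ =>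
      h.intervalIntegrable_flux (has.trans (hst.le.trans htb)) hu huK hF j
  have hsub {c e : ℝ} (hc : a ≤ c) (hce : c ≤ e) (he : e ≤ b) := hB.mono_set (c := c) (d := e) (by
    rw [Set.uIcc_of_le hce, Set.uIcc_of_le (hc.trans (hce.trans he))]
    exact Set.Icc_subset_Icc hc he)
  rw [← intervalIntegral.integral_add_adjacent_intervals (hsub le_rfl has (hst.le.trans htb))
    (hsub has hst.le htb)] at h1
  have hσ (x : V) : (σ x).real (Set.Ico a t) =
      (σ x).real (Set.Ico a s) + (σ x).real (Set.Ico s t) := by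
    rw [← Set.Ico_union_Ico_eq_Ico has hst.le,
      measureReal_union (Set.Ico_disjoint_Ico_same) measurableSet_Ico]
  simp only [hσ, mul_add, Finset.sum_add_distrib] at h1
  linarith

/-- Conservation of mass, up to the inflow at the sources. -/
theorem mass_eq (h : Γ.IsLinearSolution a b u σ p m) [∀ x, IsFiniteMeasure (σ x)]
    (hu : ∀ j, ContinuousOn (u j) (Γ.arc j).dom) {K : ℝ}
    (huK : ∀ j, ∀ s ∈ (Γ.arc j).dom, |u j s| ≤ K) {t : ℝ} (ht : t ∈ Set.Ioc a b) :
    ∑ j, (m t j).real Set.univ =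
      (∑ j, (m a j).real Set.univ) + ∑ x, (σ x).real (Set.Ico a t) := by
  have hab : a ≤ b := ht.1.le.trans ht.2
  -- All arc endpoints lie in `|s| ≤ R`, so one cut-off used on every arc has the value `1` at every
  -- vertex.
  let R := ∑ j, |(Γ.arc j).endParam|
  have hR (j : E) : |(Γ.arc j).endParam| ≤ R :=
    Finset.single_le_sum (f := fun j => |(Γ.arc j).endParam|) (fun _ _ => abs_nonneg _)
      (Finset.mem_univ j)
  choose χ hχ hχc hχI hχ1 hχd using fun n : ℕ =>
    exists_smooth_cutoff (max R n) (ε := 1 / ((n : ℝ) + 1)) (by positivity)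
  have hF (n : ℕ) : Γ.IsStaticTest (fun _ => χ n) (fun _ => 1) :=
    ⟨fun _ => hχ n, fun _ => hχc n, fun j x _ => hχ1 n _ (by
      rw [abs_zero]; exact le_max_of_le_right n.cast_nonneg),
      fun j x _ => hχ1 n _ (le_max_of_le_left (hR j))⟩
  have hlim {r : ℝ} (hr : r ∈ Set.Icc a b) : Tendsto (fun n => ∑ j, ∫ s, χ n s ∂(m r j)) atTop
      (𝓝 (∑ j, (m r j).real Set.univ)) := by
    refine tendsto_finsetSum _ fun j _ => ?_
    have := (h.arcFamily r hr j).1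
    have e : (m r j).real Set.univ = ∫ _, (1 : ℝ) ∂(m r j) := by simp
    rw [e]
    refine tendsto_integral_of_dominated_convergence (fun _ => 1)
      (fun n => (hχ n).continuous.aestronglyMeasurable) (integrable_const _)
      (fun n => ae_of_all _ fun s => ?_) (ae_of_all _ fun s => ?_)
    · rw [Real.norm_of_nonneg (hχI n s).1]; exact (hχI n s).2
    · refine tendsto_const_nhds.congr' ?_
      filter_upwards [eventually_ge_atTop ⌈|s|⌉₊] with n hn
      exact (hχ1 n s (le_max_of_le_right ((Nat.le_ceil _).trans (by exact_mod_cast hn)))).symm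
  have hM : IntervalIntegrable (fun r => ∑ j, (m r j).real Set.univ) volume a t := by
    have : IntervalIntegrable (fun r => ∑ j, (m r j).real Set.univ) volume a b := by
      simpa [Finset.sum_fn] using IntervalIntegrable.sum Finset.univ fun j _ =>
        (intervalIntegrable_iff_integrableOn_Icc_of_le hab).2 (h.integrableOn_mass j)
    exact this.mono_set (by
      rw [Set.uIcc_of_le hab, Set.uIcc_of_le ht.1.le]; exact Set.Icc_subset_Icc_right ht.2)
  -- The slope `1 / (n + 1)` beats the time integral of the mass, which is finite by definition of a
  -- solution; no prior uniform bound on the mass is needed.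
  have hzero : Tendsto (fun n => ∫ r in a..t, ∑ j, ∫ s, u j s * deriv (χ n) s ∂(m r j)) atTop
      (𝓝 0) := by
    refine squeeze_zero_norm (a := fun n : ℕ => 1 / ((n : ℝ) + 1) *
      (K * ∫ r in a..t, ∑ j, (m r j).real Set.univ)) (fun n => ?_) ?_
    · rw [← mul_assoc, ← intervalIntegral.integral_const_mul]
      refine intervalIntegral.norm_integral_le_of_norm_le ht.1.le (ae_of_all _ fun r hr => ?_)
        (hM.const_mul _)
      rw [Finset.mul_sum]
      refine (norm_sum_le _ _).trans (Finset.sum_le_sum fun j _ => ?_)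
      refine (h.arcFamily r ⟨hr.1.le, hr.2.trans ht.2⟩).abs_integral_le fun s hs => ?_
      rw [abs_mul, mul_comm]
      exact mul_le_mul (hχd n s) (huK j s hs) (abs_nonneg _) (by positivity)
    · simpa using tendsto_one_div_add_atTop_nhds_zero_nat.mul_const
        (K * ∫ r in a..t, ∑ j, (m r j).real Set.univ)
  have hl := (hlim ⟨ht.1.le, ht.2⟩).sub (hlim ⟨le_rfl, hab⟩)
  have hr := hzero.const_add (∑ x, 1 * (σ x).real (Set.Ico a t))
  have := tendsto_nhds_unique
    (hl.congr fun n => h.static_balance hu huK (hF n) ht) hr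
  simp only [one_mul, add_zero] at this
  linarith

/-- A solution with mass bounded by `B` and speed bounded by `K` satisfies a Lipschitz estimate in
time, up to the inflow at the sources. -/
theorem bl_le (h : Γ.IsLinearSolution a b u σ p m) [∀ x, IsFiniteMeasure (σ x)]
    (hu : ∀ j, ContinuousOn (u j) (Γ.arc j).dom) {K : ℝ} (hK : 0 ≤ K)
    (huK : ∀ j, ∀ s ∈ (Γ.arc j).dom, |u j s| ≤ K) {B : ℝ} (hB : 0 ≤ B)
    (hmB : ∀ r ∈ Set.Icc a b, ∑ j, (m r j).real Set.univ ≤ B) {s t : ℝ} (has : a ≤ s)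
    (hst : s < t) (htb : t ≤ b) :
    Γ.bl (Γ.toMeasure (m t)) (Γ.toMeasure (m s)) ≤
      (∑ x, σ x (Set.Ico s t)) + ENNReal.ofReal (K * 4 * B) * ENNReal.ofReal (t - s) := by
  have hs : s ∈ Set.Icc a b := ⟨has, hst.le.trans htb⟩
  have ht : t ∈ Set.Icc a b := ⟨has.trans hst.le, htb⟩
  refine iSup₂_le fun f hf => ?_
  rw [(h.arcFamily t ht).setIntegral_toMeasure hf, (h.arcFamily s hs).setIntegral_toMeasure hf,
    Real.enorm_eq_ofReal_abs]
  have hε (n : ℕ) : (0 : ℝ) < 1 / ((n : ℝ) + 1) := by positivity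
  choose g hg hgc hg2 hgd hg0 hge hgf using fun (n : ℕ) (j : E) =>
    (lipschitzOnWith_comp_param hf j).exists_contDiff_hasCompactSupport (Γ.zero_mem_dom j)
      (Γ.endParam_mem_dom j) (Γ.arc j).endParam_eq_zero_or
      (fun s hs => abs_comp_param_le_one hf j hs) n (hε n)
      ((div_le_one (by positivity)).2 (by simp))
  -- The approximations are made separately on each arc and fit together because the endpoint values
  -- are exactly those of `f`.
  have hF (n : ℕ) : Γ.IsStaticTest (g n) (fun x => f (Γ.pos x)) :=
    ⟨hg n, hgc n, fun j x hx => by rw [hg0, Γ.param_source j x hx],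
      fun j x hx => by rw [hge, Γ.param_target j x hx]⟩
  have hlim {r : ℝ} (hr : r ∈ Set.Icc a b) : Tendsto (fun n => ∑ j, ∫ y, g n j y ∂(m r j)) atTop
      (𝓝 (∑ j, ∫ y, f (Γ.param j y) ∂(m r j))) := by
    refine tendsto_finsetSum _ fun j _ => ?_
    have := (h.arcFamily r hr j).1
    have hae := (h.arcFamily r hr).ae_mem_dom j
    refine tendsto_integral_of_dominated_convergence (fun _ => 2)
      (fun n => (hg n j).continuous.aestronglyMeasurable) (integrable_const _)
      (fun n => hae.mono fun y hy => hg2 n j y hy) (hae.mono fun y hy => ?_)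
    rw [tendsto_iff_norm_sub_tendsto_zero]
    refine squeeze_zero' (Eventually.of_forall fun _ => norm_nonneg _) ?_
      tendsto_one_div_add_atTop_nhds_zero_nat
    filter_upwards [eventually_ge_atTop ⌈|y|⌉₊] with n hn
    exact hgf n j y hy ((Nat.le_ceil _).trans (by exact_mod_cast hn))
  have hbound (n : ℕ) : |(∑ j, ∫ y, g n j y ∂(m t j)) - ∑ j, ∫ y, g n j y ∂(m s j)| ≤
      (∑ x, (σ x).real (Set.Ico s t)) + K * 4 * B * (t - s) := by
    rw [h.static_balance_Ico hu huK (hF n) has hst htb]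
    refine (abs_add_le _ _).trans (add_le_add ?_ ?_)
    -- The weights are the values of `f` itself at the vertices, bounded by `1` rather than by the
    -- bound `2` for the approximations.
    · refine (Finset.abs_sum_le_sum_abs _ _).trans (Finset.sum_le_sum fun x _ => ?_)
      obtain ⟨j, hj⟩ := Γ.no_sink x
      rw [abs_mul, abs_of_nonneg measureReal_nonneg, ← Γ.param_source j x hj]
      exact mul_le_of_le_one_left measureReal_nonneg
        (abs_comp_param_le_one hf j (Γ.zero_mem_dom j))
    · rw [← abs_of_pos (sub_pos.2 hst), ← Real.norm_eq_abs (∫ _ in s..t, _)]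
      refine intervalIntegral.norm_integral_le_of_norm_le_const fun r hr => ?_
      rw [Set.uIoc_of_le hst.le] at hr
      have hr' : r ∈ Set.Icc a b := ⟨has.trans hr.1.le, hr.2.trans htb⟩
      refine le_trans ?_ (mul_le_mul_of_nonneg_left (hmB r hr') (by positivity))
      rw [Finset.mul_sum]
      refine (norm_sum_le _ _).trans (Finset.sum_le_sum fun j _ => ?_)
      refine (h.arcFamily r hr').abs_integral_le fun y hy => ?_
      rw [abs_mul]
      exact mul_le_mul (huK j y hy) (hgd n j y hy) (abs_nonneg _) hK
  have hfin := le_of_tendsto ((hlim ht).sub (hlim hs)).abs (Eventually.of_forall hbound)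
  refine (ENNReal.ofReal_le_ofReal hfin).trans (le_of_eq ?_)
  rw [ENNReal.ofReal_add (Finset.sum_nonneg fun _ _ => measureReal_nonneg)
    (mul_nonneg (by positivity) (sub_pos.2 hst).le), ENNReal.ofReal_mul (by positivity),
    ENNReal.ofReal_sum_of_nonneg fun _ _ => measureReal_nonneg]
  simp only [fun x => ofReal_measureReal (μ := σ x) (s := Set.Ico s t)]

end IsLinearSolution

/-! ## Approximate solutions -/

variable {T : ℝ} {D : Γ.Data T} {N : ℕ}

theorem Data.continuousOn_v (D : Γ.Data T) {μ : Measure (EuclideanSpace ℝ (Fin d))}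
    (hμ : Γ.IsMeasureOn μ) (j : E) : ContinuousOn (D.v μ j) (Γ.arc j).dom :=
  (LipschitzOnWith.of_dist_le_mul fun s hs s' hs' =>
    D.v_lipschitz_state μ hμ j s hs s' hs').continuousOn

theorem Data.abs_v_le (D : Γ.Data T) {μ : Measure (EuclideanSpace ℝ (Fin d))}
    (hμ : Γ.IsMeasureOn μ) (j : E) {s : ℝ} (hs : s ∈ (Γ.arc j).dom) : |D.v μ j s| ≤ D.Vmax := by
  rw [abs_of_nonneg (D.v_nonneg μ hμ j s hs)]
  exact D.v_le μ hμ j s hs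

/-- The mass that has entered the network up to time `t`. -/
noncomputable def Data.massUpTo (D : Γ.Data T) (t : ℝ) : ℝ :=
  (∑ j, (D.m0 j).real Set.univ) + ∑ x, (D.σ x).real (Set.Ico 0 t)

theorem Data.massUpTo_nonneg (D : Γ.Data T) (t : ℝ) : 0 ≤ D.massUpTo t :=
  add_nonneg (Finset.sum_nonneg fun _ _ => measureReal_nonneg)
    (Finset.sum_nonneg fun _ _ => measureReal_nonneg)

theorem Data.massUpTo_mono (D : Γ.Data T) : Monotone D.massUpTo := fun s t hst =>
  add_le_add_right (Finset.sum_le_sum fun x _ =>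
    have := D.σ_finite x; measureReal_mono (Set.Ico_subset_Ico_right hst)) _

theorem Data.massUpTo_add (D : Γ.Data T) {s t : ℝ} (hs : 0 ≤ s) (hst : s ≤ t) :
    D.massUpTo t = D.massUpTo s + ∑ x, (D.σ x).real (Set.Ico s t) := by
  rw [massUpTo, massUpTo, add_assoc, ← Finset.sum_add_distrib]
  congr 1
  refine Finset.sum_congr rfl fun x _ => ?_
  have := D.σ_finite x
  rw [← Set.Ico_union_Ico_eq_Ico hs hst,
    measureReal_union Set.Ico_disjoint_Ico_same measurableSet_Ico]

/-! ### Joining the time steps. -/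

namespace IsApproxSolution

/-- An approximate solution consists of finite measures on the arcs, of the expected mass. -/
theorem isArcFamily_and_mass_eq (h : Γ.IsApproxSolution D N m) (hT : 0 < T) {n : ℕ}
    (hn : n ≤ 2 ^ N) : ∀ t ∈ Set.Icc 0 (n * (T / 2 ^ N)),
      Γ.IsArcFamily (m t) ∧ ∑ j, (m t j).real Set.univ = D.massUpTo t := by
  have hstep : 0 < T / 2 ^ N := by positivity
  -- Both claims are carried together: the bounds on the frozen velocity require `m` at the start of
  -- the step to be a measure on the network, and its mass there is the initial value for the step.
  induction n with
  | zero =>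
    intro t ht
    obtain rfl : t = 0 := by simpa using ht
    rw [h.initial]
    exact ⟨D.m0_arcFamily, by simp [Data.massUpTo]⟩
  | succ n ih =>
    intro t ht
    rw [Nat.cast_add_one] at ht
    rcases le_or_gt t (n * (T / 2 ^ N)) with hle | hgt
    · exact ih (Nat.le_of_succ_le hn) t ⟨ht.1, hle⟩
    have h0 : 0 ≤ n * (T / 2 ^ N) := by positivity
    have hsol := h.step n hn
    obtain ⟨hfam, hmass⟩ := ih (Nat.le_of_succ_le hn) _ ⟨h0, le_rfl⟩
    have := D.σ_finite
    refine ⟨hsol.arcFamily t ⟨hgt.le, ht.2⟩, ?_⟩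
    rw [hsol.mass_eq (D.continuousOn_v hfam.isMeasureOn)
      (fun j s hs => D.abs_v_le hfam.isMeasureOn j hs) ⟨hgt, ht.2⟩, hmass,
      D.massUpTo_add h0 hgt.le]

theorem isArcFamily (h : Γ.IsApproxSolution D N m) (hT : 0 < T) {t : ℝ} (ht : t ∈ Set.Icc 0 T) :
    Γ.IsArcFamily (m t) :=
  (h.isArcFamily_and_mass_eq hT le_rfl t (by simpa [mul_div_cancel₀] using ht)).1

theorem mass_eq (h : Γ.IsApproxSolution D N m) (hT : 0 < T) {t : ℝ} (ht : t ∈ Set.Icc 0 T) :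
    ∑ j, (m t j).real Set.univ = D.massUpTo t :=
  (h.isArcFamily_and_mass_eq hT le_rfl t (by simpa [mul_div_cancel₀] using ht)).2

/-- The mass bound in terms of the bounded Lipschitz norms of the data. -/
theorem bl_zero_le (h : Γ.IsApproxSolution D N m) (hT : 0 < T) {t : ℝ} (ht : t ∈ Set.Icc 0 T) :
    Γ.bl (Γ.toMeasure (m t)) 0 ≤
      Γ.bl (Γ.toMeasure D.m0) 0 + Γ.blSpaceTime T (Γ.sourceMeasure D.σ) 0 := by
  have hfam := h.isArcFamily hT ht
  have hsum {μ : E → Measure ℝ} (hμ : Γ.IsArcFamily μ) :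
      ∑ j, μ j Set.univ = ENNReal.ofReal (∑ j, (μ j).real Set.univ) := by
    rw [ENNReal.ofReal_sum_of_nonneg fun _ _ => measureReal_nonneg]
    exact Finset.sum_congr rfl fun j _ => by
      have := (hμ j).1
      rw [ofReal_measureReal]
  refine (Network.bl_zero_le _).trans ?_
  rw [toMeasure_univ, hsum hfam, h.mass_eq hT ht, Data.massUpTo,
    ENNReal.ofReal_add (Finset.sum_nonneg fun _ _ => measureReal_nonneg)
    (Finset.sum_nonneg fun _ _ => measureReal_nonneg), ← hsum D.m0_arcFamily,
    ← toMeasure_univ (Γ := Γ),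
    ENNReal.ofReal_sum_of_nonneg fun _ _ => measureReal_nonneg]
  refine add_le_add D.m0_arcFamily.univ_le_bl ((Finset.sum_le_sum fun x _ => ?_).trans
    (sum_le_blSpaceTime D.σ_finite))
  have := D.σ_finite x
  rw [ofReal_measureReal]
  exact measure_mono (Set.Ico_subset_Icc_self.trans (Set.Icc_subset_Icc_right ht.2))

/-- Induction on the number of steps covered. If the last grid point lies strictly between `s` and
`t`, the interval is split there; both terms of the bound are additive, so the constant does not
grow with the number of steps. -/
theorem bl_le_of_le (h : Γ.IsApproxSolution D N m) (hT : 0 < T) {n : ℕ} (hn : n ≤ 2 ^ N) :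
    ∀ s t, 0 ≤ s → s < t → t ≤ n * (T / 2 ^ N) →
      Γ.bl (Γ.toMeasure (m t)) (Γ.toMeasure (m s)) ≤ (∑ x, D.σ x (Set.Ico s t)) +
        ENNReal.ofReal (D.Vmax * 4 * D.massUpTo T) * ENNReal.ofReal (t - s) := by
  have hstep : 0 < T / 2 ^ N := by positivity
  have hle {k : ℕ} (hk : k ≤ 2 ^ N) : k * (T / 2 ^ N) ≤ T := by
    rw [mul_div_assoc', div_le_iff₀ (by positivity), mul_comm]
    exact mul_le_mul_of_nonneg_left (by exact_mod_cast hk) hT.le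
  induction n with
  | zero =>
    intro s t hs hst ht
    rw [Nat.cast_zero, zero_mul] at ht
    linarith
  | succ n ih =>
    have ih := ih (Nat.le_of_succ_le hn)
    intro s t hs hst ht
    have hleT := hle hn
    rw [Nat.cast_add_one] at ht hleT
    rcases le_or_gt t (n * (T / 2 ^ N)) with htn | htn
    · exact ih s t hs hst htn
    have h0 : 0 ≤ n * (T / 2 ^ N) := by positivity
    have := D.σ_finite
    have hfam := (h.isArcFamily hT ⟨h0, hle (Nat.le_of_succ_le hn)⟩).isMeasureOn
    have hloc {s : ℝ} (hs : n * (T / 2 ^ N) ≤ s) (hst : s < t) :=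
      (h.step n hn).bl_le (D.continuousOn_v hfam) D.Vmax_pos.le
        (fun j y hy => D.abs_v_le hfam j hy) (D.massUpTo_nonneg T) (fun r hr =>
          (h.mass_eq hT ⟨h0.trans hr.1, hr.2.trans hleT⟩).trans_le
            (D.massUpTo_mono (hr.2.trans hleT))) hs hst ht
    rcases le_or_gt (n * (T / 2 ^ N)) s with hns | hsn
    · exact hloc hns hst
    · refine (bl_triangle _ (Γ.toMeasure (m (n * (T / 2 ^ N)))) _).trans
        ((add_le_add (hloc le_rfl htn) (ih s _ hs hsn le_rfl)).trans (le_of_eq ?_))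
      have hσ (x : V) : D.σ x (Set.Ico s t) = D.σ x (Set.Ico s (n * (T / 2 ^ N))) +
          D.σ x (Set.Ico (n * (T / 2 ^ N)) t) := by
        rw [← Set.Ico_union_Ico_eq_Ico hsn.le htn.le,
          measure_union Set.Ico_disjoint_Ico_same measurableSet_Ico]
      have hts : t - s = (t - n * (T / 2 ^ N)) + (n * (T / 2 ^ N) - s) := by ring
      rw [hts, ENNReal.ofReal_add (sub_pos.2 htn).le (sub_pos.2 hsn).le]
      simp only [hσ, Finset.sum_add_distrib]
      ring

/-- The Lipschitz estimate in time, up to the inflow at the sources. -/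
theorem bl_le (h : Γ.IsApproxSolution D N m) (hT : 0 < T) {s t : ℝ} (hs : 0 ≤ s) (hst : s < t)
    (ht : t ≤ T) :
    Γ.bl (Γ.toMeasure (m t)) (Γ.toMeasure (m s)) ≤ (∑ x, D.σ x (Set.Ico s t)) +
      ENNReal.ofReal (D.Vmax * 4 * D.massUpTo T) * ENNReal.ofReal (t - s) :=
  h.bl_le_of_le hT le_rfl s t hs hst (by simpa [mul_div_cancel₀] using ht)

end IsApproxSolution

end Network

theorem proposition4p1 (T : ℝ) (hT : 0 < T) :
    (∃ C : ℝ≥0, 0 < C ∧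
      ∀ (V E : Type) [Fintype V] [Fintype E] (d : ℕ) (Γ : Network V E d) (D : Γ.Data T)
        (N : ℕ) (m : ℝ → E → Measure ℝ), Γ.IsApproxSolution D N m →
        ∀ t ∈ Set.Icc 0 T,
          Γ.bl (Γ.toMeasure (m t)) 0 ≤
            C * (Γ.bl (Γ.toMeasure D.m0) 0 + Γ.blSpaceTime T (Γ.sourceMeasure D.σ) 0)) ∧
    (∀ (V E : Type) [Fintype V] [Fintype E] (d : ℕ) (Γ : Network V E d) (D : Γ.Data T),
      ∃ C : ℝ≥0, 0 < C ∧
        ∀ (N : ℕ) (m : ℝ → E → Measure ℝ), Γ.IsApproxSolution D N m →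
          ∀ s t : ℝ, 0 ≤ s → s < t → t ≤ T →
            Γ.bl (Γ.toMeasure (m t)) (Γ.toMeasure (m s)) ≤
              (∑ x, D.σ x (Set.Ico s t)) + C * ENNReal.ofReal (t - s)) := by
  refine ⟨⟨1, one_pos, fun V E _ _ d Γ D N m h t ht => ?_⟩, fun V E _ _ d Γ D => ?_⟩
  · simpa using h.bl_zero_le hT ht
  -- The factor `4` is the slope bound of the smooth approximations. Adding `1` keeps the constant
  -- positive even when no mass is present.
  · refine ⟨(D.Vmax * 4 * D.massUpTo T).toNNReal + 1, by positivity,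
      fun N m h s t hs hst ht => (h.bl_le hT hs hst ht).trans ?_⟩
    gcongr
    exact ENNReal.coe_le_coe.2 le_self_add
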